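/- Let $\mathbb{H}$ be the Heisenberg group, i.e. $\mathbb{R}^3\cong\mathbb{C}\times\mathbb{R}$ with the product $(x,y,t)\cdot(x',y',t')=(x+x',\,y+y',\,t+t'+\tfrac12(xy'-yx'))$, the homogeneous norm $\|(z,t)\|=\max\{|z|,|t|^{1/2}\}$ (where $z=x+iy$) and the metric $d(p,q)=\|q^{-1}\cdot p\|$. Let $B(x,r)$ denote closed balls, $\mathcal{H}^3$ the 3-dimensional Hausdorff measure, and $\operatorname{diam}$ and $\operatorname{dist}$ the diameter and the distance, all with respect to $d$; a diameter may be infinite, and radii $r,s,R$ below are real numbers. A *vertical subgroup* is a set $\mathbb{W}=V\times\mathbb{R}$ with $V\subset\mathbb{C}$ a line through the origin, and its complementary horizontal subgroup is $\mathbb{V}=V^\perp\times\{0\}$. Each $p\in\mathbb{H}$ is written uniquely as $p=p_{\mathbb{W}}\cdot p_{\mathbb{V}}$ with $p_{\mathbb{W}}\in\mathbb{W}$, $p_{\mathbb{V}}\in\mathbb{V}$; put $\pi_{\mathbb{W}}(p)=p_{\mathbb{W}}$. Let $\mathcal{L}^2$ be the 2-dimensional Lebesgue measure on $\mathbb{W}\cong\mathbb{R}^2$.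 For $\alpha>0$ let $C_{\mathbb{W}}(\alpha)=\{p\in\mathbb{H}:\|p_{\mathbb{W}}\|\le\alpha\|p_{\mathbb{V}}\|\}$. A set $\Gamma\subset\mathbb{H}$ is an *intrinsic $L$-Lipschitz graph over $\mathbb{W}$* if $(x\cdot C_{\mathbb{W}}(\alpha))\cap\Gamma=\{x\}$ for all $x\in\Gamma$ and all $0<\alpha<1/L$. Let $E\subset\mathbb{H}$ be a set with the following three properties. 1. ($3$-Ahlfors-David regularity) $E$ is closed and there is a constant $1\le C<\infty$ such that $C^{-1}r^3\le\mathcal{H}^3(B(x,r)\cap E)\le Cr^3$ for all $x\in E$ and $0<r\le\operatorname{diam}(E)$. 2. (Weak geometric lemma for vertical $\beta$-numbers) For $x\in E$ and $r>0$ put $$\beta(B(x,r))=\inf_{\mathbb{W},\,z}\ \sup_{y\in B(x,r)\cap E}\frac{\operatorname{dist}(y,z\cdot\mathbb{W})}{r},$$ the infimum being over all vertical subgroups $\mathbb{W}$ and all $z\in\mathbb{H}$. For every $\varepsilon>0$ there is a constant $C_\varepsilon<\infty$ such that for all $x\in E$ and $R>0$ $$\int_0^R\mathcal{H}^3\big(\{y\in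 E\cap B(x,R):\beta(B(y,s))>\varepsilon\}\big)\,\frac{ds}{s}\le C_\varepsilon R^3 .$$ 3. (Big vertical projections) There is $\delta>0$ such that for all $x\in E$ and $0<R\le\operatorname{diam}(E)$ there is a vertical subgroup $\mathbb{W}$ with $\mathcal{L}^2(\pi_{\mathbb{W}}(E\cap B(x,R)))\ge\delta R^3$. Then $E$ has big pieces of intrinsic Lipschitz graphs: there are constants $L\ge1$ and $\theta>0$ such that for all $x\in E$ and $0<R\le\operatorname{diam}(E)$ there is an intrinsic $L$-Lipschitz graph $\Gamma$ over some vertical subgroup with $$\mathcal{H}^3(E\cap\Gamma\cap B(x,R))\ge\theta R^3 .$$ -/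

import Mathlib

open MeasureTheory Set
open scoped ENNReal

noncomputable section

/-- The Heisenberg group, as a set: `ℂ × ℝ`, i.e. `ℝ³` with `(x, y, t)` written `(x + iy, t)`. -/
@[ext]
structure Heisenberg where
  /-- The horizontal component `z = x + iy`. -/
  z : ℂ
  /-- The vertical component. -/
  t : ℝ

namespace Heisenberg

/-- `(x,y,t) · (x',y',t') = (x + x', y + y', t + t' + (x y' - y x') / 2)`. -/
instance : Mul Heisenberg :=
  ⟨fun p q => ⟨p.z + q.z, p.t + q.t + (p.z.re * q.z.im - p.z.im * q.z.re) / 2⟩⟩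

instance : One Heisenberg := ⟨⟨0, 0⟩⟩

instance : Inv Heisenberg := ⟨fun p => ⟨-p.z, -p.t⟩⟩

@[simp] theorem mul_z (p q : Heisenberg) : (p * q).z = p.z + q.z := rfl

@[simp] theorem mul_t (p q : Heisenberg) :
    (p * q).t = p.t + q.t + (p.z.re * q.z.im - p.z.im * q.z.re) / 2 := rfl

@[simp] theorem one_z : (1 : Heisenberg).z = 0 := rfl

@[simp] theorem one_t : (1 : Heisenberg).t = 0 := rfl

@[simp] theorem inv_z (p : Heisenberg) : (p⁻¹).z = -p.z := rfl

@[simp] theorem inv_t (p : Heisenberg) : (p⁻¹).t = -p.t := rfl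

instance : Group Heisenberg :=
  Group.ofLeftAxioms
    (fun p q r => by
      refine Heisenberg.ext (add_assoc _ _ _) ?_
      simp; ring)
    (fun p => by refine Heisenberg.ext ?_ ?_ <;> simp)
    (fun p => by
      refine Heisenberg.ext ?_ ?_
      · simp
      · simp; ring)

/-- The homogeneous norm `‖(z,t)‖ = max {|z|, |t|^{1/2}}`. -/
def hnorm (p : Heisenberg) : ℝ := max ‖p.z‖ (Real.sqrt |p.t|)

theorem hnorm_nonneg (p : Heisenberg) : 0 ≤ hnorm p :=
  le_max_of_le_left (norm_nonneg _)

theorem hnorm_inv (p : Heisenberg) : hnorm p⁻¹ = hnorm p := by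
  simp [hnorm]

theorem eq_one_of_hnorm_eq_zero {p : Heisenberg} (h : hnorm p = 0) : p = 1 := by
  have h1 : ‖p.z‖ ≤ 0 := h ▸ le_max_left _ _
  have h2 : Real.sqrt |p.t| ≤ 0 := h ▸ le_max_right _ _
  have h3 : |p.t| ≤ 0 := Real.sqrt_eq_zero'.1 (le_antisymm h2 (Real.sqrt_nonneg _))
  have hz : p.z = 0 := norm_le_zero_iff.1 h1
  have ht : p.t = 0 := abs_nonpos_iff.1 h3
  exact Heisenberg.ext hz ht

theorem abs_symplectic_le (z w : ℂ) : |z.re * w.im - z.im * w.re| ≤ ‖z‖ * ‖w‖ := by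
  have h : z.re * w.im - z.im * w.re = ((starRingEnd ℂ) z * w).im := by
    simp; ring
  rw [h]
  calc |((starRingEnd ℂ) z * w).im| ≤ ‖(starRingEnd ℂ) z * w‖ := Complex.abs_im_le_norm _
    _ = ‖z‖ * ‖w‖ := by rw [norm_mul, RCLike.norm_conj]

theorem hnorm_mul_le (p q : Heisenberg) : hnorm (p * q) ≤ hnorm p + hnorm q := by
  have hp := hnorm_nonneg p
  have hq := hnorm_nonneg q
  have hpz : ‖p.z‖ ≤ hnorm p := le_max_left _ _
  have hqz : ‖q.z‖ ≤ hnorm q := le_max_left _ _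
  have hpt : |p.t| ≤ hnorm p ^ 2 := (Real.sqrt_le_left hp).1 (le_max_right _ _)
  have hqt : |q.t| ≤ hnorm q ^ 2 := (Real.sqrt_le_left hq).1 (le_max_right _ _)
  refine max_le ?_ ?_
  · exact (norm_add_le _ _).trans (add_le_add hpz hqz)
  · refine (Real.sqrt_le_left (add_nonneg hp hq)).2 ?_
    have h1 := abs_symplectic_le p.z q.z
    have h2 : ‖p.z‖ * ‖q.z‖ ≤ hnorm p * hnorm q :=
      mul_le_mul hpz hqz (norm_nonneg _) hp
    have h0 := mul_nonneg hp hq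
    rw [mul_t, abs_le]
    rw [abs_le] at h1 hpt hqt
    constructor <;> nlinarith [h1.1, h1.2, hpt.1, hpt.2, hqt.1, hqt.2]

/-- The metric `d(p,q) = ‖q⁻¹ · p‖`. -/
instance : MetricSpace Heisenberg where
  dist p q := hnorm (q⁻¹ * p)
  dist_self p := by simp [hnorm]
  dist_comm p q := by
    rw [← hnorm_inv]; congr 1; group
  dist_triangle p q r := by
    have h : r⁻¹ * p = (r⁻¹ * q) * (q⁻¹ * p) := by group
    rw [h, add_comm]
    exact hnorm_mul_le _ _
  eq_of_dist_eq_zero {p q} h := (inv_mul_eq_one.1 (eq_one_of_hnorm_eq_zero h)).symm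

theorem dist_def (p q : Heisenberg) : dist p q = hnorm (q⁻¹ * p) := rfl

instance : MeasurableSpace Heisenberg := borel Heisenberg

instance : BorelSpace Heisenberg := ⟨rfl⟩

/-- A closed set `E` is `3`-(Ahlfors-David-)regular if, for some `1 ≤ C < ∞`,
`C⁻¹ r³ ≤ ℋ³(B(x,r) ∩ E) ≤ C r³` for all `x ∈ E` and all real `r` with `0 < r ≤ diam E`
(the diameter being allowed to be infinite). -/
def IsThreeRegular (E : Set Heisenberg) : Prop :=
  IsClosed E ∧ ∃ C : ℝ, 1 ≤ C ∧ ∀ x ∈ E, ∀ r : ℝ, 0 < r → ENNReal.ofReal r ≤ Metric.ediam E →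
    ENNReal.ofReal (C⁻¹ * r ^ 3) ≤ μH[3] (Metric.closedBall x r ∩ E) ∧
      μH[3] (Metric.closedBall x r ∩ E) ≤ ENNReal.ofReal (C * r ^ 3)

/-- A vertical subgroup `𝕎 = V × ℝ`, where `V ⊆ ℂ` is a line through the origin. The line is given
by a unit vector spanning it (`e` and `-e` give the same subgroup, and nothing below distinguishes
between them). -/
structure VerticalSubgroup where
  /-- A unit vector spanning the line `V`. -/
  dir : ℂ
  norm_dir : ‖dir‖ = 1

namespace VerticalSubgroup

/-- The line `V` with `𝕎 = V × ℝ`. -/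
def line (W : VerticalSubgroup) : Submodule ℝ ℂ := Submodule.span ℝ {W.dir}

/-- The subgroup `𝕎 = V × ℝ` of the Heisenberg group. -/
def toSubgroup (W : VerticalSubgroup) : Subgroup Heisenberg where
  carrier := {p | p.z ∈ W.line}
  mul_mem' hp hq := W.line.add_mem hp hq
  one_mem' := W.line.zero_mem
  inv_mem' hp := W.line.neg_mem hp

instance (W : VerticalSubgroup) : W.line.HasOrthogonalProjection := by
  unfold line; infer_instance

/-- The complementary horizontal subgroup `𝕍 = V^⊥ × {0}`. -/
def complement (W : VerticalSubgroup) : Subgroup Heisenberg where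
  carrier := {p | p.z ∈ W.lineᗮ ∧ p.t = 0}
  mul_mem' {p q} hp hq := by
    refine ⟨W.lineᗮ.add_mem hp.1 hq.1, ?_⟩
    have hd : W.dir ∈ W.line := Submodule.mem_span_singleton_self _
    have h1 := (Submodule.mem_orthogonal _ _).1 hp.1 _ hd
    have h2 := (Submodule.mem_orthogonal _ _).1 hq.1 _ hd
    have hn : W.dir.re * W.dir.re + W.dir.im * W.dir.im = 1 := by
      rw [← Complex.normSq_apply, Complex.normSq_eq_norm_sq, W.norm_dir, one_pow]
    simp only [Complex.inner, Complex.mul_re, Complex.conj_re, Complex.conj_im] at h1 h2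
    have h3 : p.z.re * q.z.im - p.z.im * q.z.re = 0 := by
      linear_combination (q.z.im * W.dir.re - q.z.re * W.dir.im) * h1 -
        (p.z.im * W.dir.re - p.z.re * W.dir.im) * h2 -
        (p.z.re * q.z.im - p.z.im * q.z.re) * hn
    rw [mul_t, hp.2, hq.2, h3]; simp
  one_mem' := ⟨W.lineᗮ.zero_mem, rfl⟩
  inv_mem' hp := ⟨W.lineᗮ.neg_mem hp.1, by simp [hp.2]⟩

/-- The horizontal projection: the component `p_𝕍` in `p = p_𝕎 · p_𝕍`. -/
def projH (W : VerticalSubgroup) (p : Heisenberg) : Heisenberg :=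
  ⟨W.lineᗮ.starProjection p.z, 0⟩

/-- The vertical projection: the component `p_𝕎` in `p = p_𝕎 · p_𝕍`. -/
def projV (W : VerticalSubgroup) (p : Heisenberg) : Heisenberg := p * (W.projH p)⁻¹

theorem projH_mem (W : VerticalSubgroup) (p : Heisenberg) : W.projH p ∈ W.complement :=
  ⟨Submodule.starProjection_apply_mem _ _, rfl⟩

theorem projV_mem (W : VerticalSubgroup) (p : Heisenberg) : W.projV p ∈ W.toSubgroup := by
  change p.z + -(W.lineᗮ.starProjection p.z) ∈ W.line
  rw [Submodule.starProjection_orthogonal_val]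
  simp

theorem projV_mul_projH (W : VerticalSubgroup) (p : Heisenberg) :
    W.projV p * W.projH p = p := by
  simp [projV]

/-- The splitting `p = p_𝕎 · p_𝕍` is unique. -/
theorem eq_proj_of_mul_eq (W : VerticalSubgroup) {p w v : Heisenberg} (hw : w ∈ W.toSubgroup)
    (hv : v ∈ W.complement) (h : w * v = p) : w = W.projV p ∧ v = W.projH p := by
  have hz : w.z + v.z = p.z := by rw [← h]; rfl
  have hv' : v = W.projH p := by
    refine Heisenberg.ext ?_ hv.2
    change v.z = W.lineᗮ.starProjection p.z
    have hw' : w.z ∈ W.line := hw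
    have hwo : w.z ∈ W.lineᗮᗮ := Submodule.le_orthogonal_orthogonal _ hw'
    rw [← hz, map_add, (Submodule.starProjection_apply_eq_zero_iff _).2 hwo,
      Submodule.starProjection_eq_self_iff.2 hv.1, zero_add]
  refine ⟨?_, hv'⟩
  rw [projV, ← hv', ← h]
  simp

/-- The two-dimensional Lebesgue measure `ℒ²(A)` of a set `A ⊆ 𝕎`, where `𝕎 = V × ℝ` is identified
with `ℝ²` through `(s, t) ↦ (s e, t)`, with `e` a unit vector spanning `V`. -/
def area (W : VerticalSubgroup) (A : Set Heisenberg) : ℝ≥0∞ :=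
  volume {q : ℝ × ℝ | (⟨q.1 • W.dir, q.2⟩ : Heisenberg) ∈ A}

/-- The cone `C_𝕎(α) = {p : ‖p_𝕎‖ ≤ α ‖p_𝕍‖}` perpendicular to `𝕎`, of aperture `α`. -/
def cone (W : VerticalSubgroup) (α : ℝ) : Set Heisenberg :=
  {p | hnorm (W.projV p) ≤ α * hnorm (W.projH p)}

/-- `Γ` is an intrinsic `L`-Lipschitz graph over `𝕎`: `(x · C_𝕎(α)) ∩ Γ = {x}` for all `x ∈ Γ` and
`0 < α < 1/L`. -/
def IsIntrinsicLipschitzGraph (W : VerticalSubgroup) (L : ℝ) (Γ : Set Heisenberg) : Prop :=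
  ∀ x ∈ Γ, ∀ α : ℝ, 0 < α → α < 1 / L → ((fun p => x * p) '' W.cone α) ∩ Γ = {x}

/-- The coset `z · 𝕎`. -/
def coset (W : VerticalSubgroup) (z : Heisenberg) : Set Heisenberg :=
  (fun p => z * p) '' (W.toSubgroup : Set Heisenberg)

end VerticalSubgroup

/-- `β_E(B; z · 𝕎)` for the ball `B = B(x,r)`: the supremum over `y ∈ B ∩ E` of
`dist(y, z · 𝕎) / r`. -/
def betaPlane (E : Set Heisenberg) (x : Heisenberg) (r : ℝ) (W : VerticalSubgroup)
    (z : Heisenberg) : ℝ≥0∞ :=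
  ⨆ y ∈ Metric.closedBall x r ∩ E, Metric.infEDist y (W.coset z) / ENNReal.ofReal r

/-- The vertical `β`-number `β_E(B(x,r))`: the infimum of `β_E(B(x,r); z · 𝕎)` over all vertical
subgroups `𝕎` and all points `z`. -/
def beta (E : Set Heisenberg) (x : Heisenberg) (r : ℝ) : ℝ≥0∞ :=
  ⨅ (W : VerticalSubgroup) (z : Heisenberg), betaPlane E x r W z

/-- The weak geometric lemma for vertical `β`-numbers: for every `ε > 0` there is a constant `C`
such that for all `x ∈ E` and `R > 0`,
`∫_0^R ∫_{E ∩ B(x,R)} χ_{{(y,s) : β(B(y,s)) > ε}} dℋ³(y) ds/s ≤ C R³`. -/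
def SatisfiesWGL (E : Set Heisenberg) : Prop :=
  ∀ ε : ℝ, 0 < ε → ∃ C : ℝ, ∀ x ∈ E, ∀ R : ℝ, 0 < R →
    ∫⁻ s in Ioc 0 R,
        (∫⁻ y in E ∩ Metric.closedBall x R,
          {y' : Heisenberg | ENNReal.ofReal ε < beta E y' s}.indicator 1 y ∂μH[3]) /
            ENNReal.ofReal s
      ≤ ENNReal.ofReal (C * R ^ 3)

/-- Big vertical projections. -/
def HasBVP (E : Set Heisenberg) : Prop :=
  ∃ δ : ℝ, 0 < δ ∧ ∀ x ∈ E, ∀ R : ℝ, 0 < R → ENNReal.ofReal R ≤ Metric.ediam E →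
    ∃ W : VerticalSubgroup,
      ENNReal.ofReal (δ * R ^ 3) ≤ W.area (W.projV '' (E ∩ Metric.closedBall x R))

/-- Big pieces of intrinsic Lipschitz graphs. -/
def HasBPiLG (E : Set Heisenberg) : Prop :=
  ∃ L θ : ℝ, 1 ≤ L ∧ 0 < θ ∧ ∀ x ∈ E, ∀ R : ℝ, 0 < R → ENNReal.ofReal R ≤ Metric.ediam E →
    ∃ (W : VerticalSubgroup) (Γ : Set Heisenberg), W.IsIntrinsicLipschitzGraph L Γ ∧
      ENNReal.ofReal (θ * R ^ 3) ≤ μH[3] (E ∩ Γ ∩ Metric.closedBall x R)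

end Heisenberg

end

noncomputable section

namespace Heisenberg

/-! Fix a ball and a vertical subgroup `W` onto which it projects with large area. Two kinds of bad
points cost little projected area. Points centring a smaller ball with small projection are handled
by a Vitali covering and regularity (`RegularWith.volume_shadow_le`). Points near nonflat points at
more than `N` dyadic scales have small measure by the weak geometric lemma and Markov's inequality
(`tsum_measure_thickening_le`, `mul_measure_encard_le`), and projecting costs at most a factor 6
(`volume_shadow_le_hausdorff`).

Let `p`, `q` be remaining points. If the ball around one of them, at the scale of their distance, is
flat, then it lies over a thin planar strip. Its large projection keeps the strip from being nearly
perpendicular to the line of `W`, and this gives the cone condition for `p`, `q`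
(`projH_le_of_strip`). So only pairs that are both nonflat at the scale of their distance can
violate it. Since each point meets few nonflat scales, `exists_coding` splits the remaining set into
boundedly many pieces without such pairs. By pigeonhole one piece has large projection, hence large
measure, and its closure is the graph. -/

theorem norm_z_sub_le_dist (p q : Heisenberg) : ‖p.z - q.z‖ ≤ dist p q := by
  have h : p.z - q.z = (q⁻¹ * p).z := by simp; ring
  rw [h]
  exact le_max_left _ _

theorem abs_t_le_hnorm_sq (p : Heisenberg) : |p.t| ≤ hnorm p ^ 2 :=
  (Real.sqrt_le_left (hnorm_nonneg p)).1 (le_max_right _ _)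

/-! ### Coordinates adapted to a vertical subgroup, and areas of vertical projections. -/

namespace VerticalSubgroup

variable (W : VerticalSubgroup)

/-- The coordinate of the horizontal component along the line `V`. -/
def along (p : Heisenberg) : ℝ := W.dir.re * p.z.re + W.dir.im * p.z.im

/-- The coordinate of the horizontal component across the line `V`. -/
def across (p : Heisenberg) : ℝ := W.dir.re * p.z.im - W.dir.im * p.z.re

/-- The coordinates in the plane `𝕎 ≅ ℝ²` of the vertical projection of a point. -/
def shadow (p : Heisenberg) : ℝ × ℝ := (W.along p, p.t - W.along p * W.across p / 2)

theorem dir_sq : W.dir.re * W.dir.re + W.dir.im * W.dir.im = 1 := by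
  rw [← Complex.normSq_apply, Complex.normSq_eq_norm_sq, W.norm_dir, one_pow]

theorem along_sq_add_across_sq (p : Heisenberg) :
    W.along p ^ 2 + W.across p ^ 2 = ‖p.z‖ ^ 2 := by
  rw [← Complex.normSq_eq_norm_sq, Complex.normSq_apply, along, across]
  linear_combination (p.z.re * p.z.re + p.z.im * p.z.im) * W.dir_sq

theorem abs_along_le (p : Heisenberg) : |W.along p| ≤ ‖p.z‖ :=
  abs_le_of_sq_le_sq (by nlinarith [W.along_sq_add_across_sq p, sq_nonneg (W.across p)])
    (norm_nonneg _)

theorem abs_across_le (p : Heisenberg) : |W.across p| ≤ ‖p.z‖ :=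
  abs_le_of_sq_le_sq (by nlinarith [W.along_sq_add_across_sq p, sq_nonneg (W.along p)])
    (norm_nonneg _)

/-- The map to `(along, across)` is multiplication by the conjugate of the unit vector `W.dir`, a
rotation, so it preserves the symplectic form. -/
theorem symplectic_eq (p q : Heisenberg) :
    p.z.re * q.z.im - p.z.im * q.z.re = W.along p * W.across q - W.across p * W.along q := by
  simp only [along, across]
  linear_combination (-(p.z.re * q.z.im - p.z.im * q.z.re)) * W.dir_sq

theorem along_inv_mul (p q : Heisenberg) : W.along (p⁻¹ * q) = W.along q - W.along p := by
  simp [along]; ring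

theorem across_inv_mul (p q : Heisenberg) : W.across (p⁻¹ * q) = W.across q - W.across p := by
  simp [across]; ring

theorem proj_eq (p : Heisenberg) :
    W.projV p = ⟨W.along p • W.dir, p.t - W.along p * W.across p / 2⟩ ∧
      W.projH p = ⟨W.across p • (Complex.I * W.dir), 0⟩ := by
  have hd := W.dir_sq
  have h := W.eq_proj_of_mul_eq (p := p)
    (w := ⟨W.along p • W.dir, p.t - W.along p * W.across p / 2⟩)
    (v := ⟨W.across p • (Complex.I * W.dir), 0⟩) ?_ ?_ ?_
  · exact ⟨h.1.symm, h.2.symm⟩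
  · exact W.line.smul_mem _ (Submodule.mem_span_singleton_self _)
  · refine ⟨W.lineᗮ.smul_mem _ ?_, rfl⟩
    rw [line, Submodule.mem_orthogonal_singleton_iff_inner_right]
    simp only [Complex.inner, Complex.mul_re, Complex.conj_re, Complex.conj_im, Complex.I_re,
      Complex.I_im, Complex.mul_im]
    ring
  · refine Heisenberg.ext (Complex.ext ?_ ?_) ?_
    · simp [along, across]
      linear_combination p.z.re * hd
    · simp [along, across]
      linear_combination p.z.im * hd
    · simp
      linear_combination (W.along p * W.across p / 2) * hd

theorem area_projV_image (A : Set Heisenberg) :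
    W.area (W.projV '' A) = volume (W.shadow '' A) := by
  unfold area
  congr 1
  have hd := W.dir_sq
  ext ⟨a, s⟩
  simp only [mem_ofPred_eq, mem_image]
  refine exists_congr fun p => and_congr_right fun _ => ?_
  rw [(W.proj_eq p).1, shadow, Heisenberg.ext_iff, Prod.ext_iff]
  refine and_congr_left fun _ => ⟨fun h => ?_, fun h => ?_⟩
  · have h1 := congrArg Complex.re h
    have h2 := congrArg Complex.im h
    simp only [Complex.real_smul, Complex.re_ofReal_mul, Complex.im_ofReal_mul] at h1 h2
    linear_combination W.dir.re * h1 + W.dir.im * h2 - (W.along p - a) * hd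
  · simp only at h ⊢
    rw [h]

/-- A vertical strip around the graph of an affine function has the expected area. -/
theorem volume_sheared_rectangle_le (a c b s : ℝ) {ρ h : ℝ} (hρ : 0 ≤ ρ) :
    volume {q : ℝ × ℝ | |q.1 - a| ≤ ρ ∧ |q.2 - (s + (q.1 - c) * b)| ≤ h} ≤
      ENNReal.ofReal (4 * ρ * h) := by
  have hm : MeasurableSet {q : ℝ × ℝ | |q.1 - a| ≤ ρ ∧ |q.2 - (s + (q.1 - c) * b)| ≤ h} := by
    refine IsClosed.measurableSet (IsClosed.and ?_ ?_) <;>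
      exact isClosed_le (by fun_prop) (by fun_prop)
  rw [Measure.volume_eq_prod, Measure.prod_apply hm]
  calc ∫⁻ x, volume (Prod.mk x ⁻¹' {q : ℝ × ℝ | |q.1 - a| ≤ ρ ∧ |q.2 - (s + (q.1 - c) * b)| ≤ h})
      ≤ ∫⁻ x, (Metric.closedBall a ρ).indicator (fun _ => ENNReal.ofReal (2 * h)) x := by
        refine lintegral_mono fun x => ?_
        by_cases hx : x ∈ Metric.closedBall a ρ
        · rw [indicator_of_mem hx, ← Real.volume_closedBall (s + (x - c) * b)]
          refine measure_mono fun y hy => ?_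
          exact hy.2
        · rw [indicator_of_notMem hx]
          have : Prod.mk x ⁻¹' {q : ℝ × ℝ | |q.1 - a| ≤ ρ ∧
              |q.2 - (s + (q.1 - c) * b)| ≤ h} = ∅ := by
            ext y
            simp only [mem_preimage, mem_ofPred_eq, mem_empty_iff_false, iff_false, not_and]
            exact fun hy => absurd hy hx
          simp [this]
    _ = ENNReal.ofReal (4 * ρ * h) := by
        rw [lintegral_indicator_const Metric.isClosed_closedBall.measurableSet,
          Real.volume_closedBall, ← ENNReal.ofReal_mul' (by positivity)]
        congr 1
        ring

/-- The part of a ball within distance `ρ` of a vertical plane orthogonal to `𝕎` has a small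
projection to `𝕎`. -/
theorem volume_shadow_le {A : Set Heisenberg} {x : Heisenberg} {r ρ : ℝ} (hρ : 0 ≤ ρ)
    (hA : A ⊆ Metric.closedBall x r) (hA' : ∀ y ∈ A, |W.along y - W.along x| ≤ ρ) :
    volume (W.shadow '' A) ≤ ENNReal.ofReal (6 * ρ * r ^ 2) := by
  -- Left translation by `x` acts on shadows as a translated shear, which preserves area. The
  -- half-height is `r² + r²/2`: a bound for `|t|` plus half of one for `|along * across|`, both
  -- relative to `x`.
  refine (measure_mono ?_).trans ((volume_sheared_rectangle_le (W.along x) (W.along x)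
    (- W.across x) (x.t - W.across x * W.along x / 2) (h := 3 / 2 * r ^ 2) hρ).trans_eq
      (by congr 1; ring))
  rintro _ ⟨y, hy, rfl⟩
  refine ⟨hA' y hy, ?_⟩
  have hd : hnorm (x⁻¹ * y) ≤ r := hA hy
  have h0 := hnorm_nonneg (x⁻¹ * y)
  have hr : 0 ≤ r := h0.trans hd
  have hz : ‖(x⁻¹ * y).z‖ ≤ r := (le_max_left _ _).trans hd
  have ht := (abs_t_le_hnorm_sq (x⁻¹ * y)).trans (pow_le_pow_left₀ h0 hd 2)
  have ha := (W.abs_along_le (x⁻¹ * y)).trans hz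
  have hb := (W.abs_across_le (x⁻¹ * y)).trans hz
  have hab : |W.along (x⁻¹ * y) * W.across (x⁻¹ * y)| ≤ r ^ 2 := by
    rw [abs_mul, sq]
    exact mul_le_mul ha hb (abs_nonneg _) hr
  have hs := W.symplectic_eq x y
  have hteq : (x⁻¹ * y).t = y.t - x.t - (x.z.re * y.z.im - x.z.im * y.z.re) / 2 := by
    simp; ring
  have key : (W.shadow y).2 - (x.t - W.across x * W.along x / 2 +
      ((W.shadow y).1 - W.along x) * (- W.across x)) =
      (x⁻¹ * y).t - W.along (x⁻¹ * y) * W.across (x⁻¹ * y) / 2 := by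
    rw [hteq, hs, along_inv_mul, across_inv_mul]
    simp only [shadow]
    ring
  rw [key]
  rw [abs_le] at ht hab ⊢
  constructor <;> linarith [ht.1, ht.2, hab.1, hab.2]

/-- Vertical projections do not increase `3`-dimensional measure by more than a constant. -/
theorem volume_shadow_le_hausdorff (A : Set Heisenberg) :
    volume (W.shadow '' A) ≤ 6 * μH[3] A := by
  -- Comparing outer measures requires no measurability of `A`. A set of diameter `d` lies in a ball
  -- of radius `d` about any of its points, so its shadow has area at most `6 d³`.
  let ν : OuterMeasure Heisenberg := OuterMeasure.comap W.shadow (volume : Measure _).toOuterMeasure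
  have hν : ∀ s, ν s = volume (W.shadow '' s) := fun s => rfl
  have h6 : (6 : ℝ≥0∞)⁻¹ * 6 = 1 := ENNReal.inv_mul_cancel (by norm_num) (by norm_num)
  have key : (6 : ℝ≥0∞)⁻¹ • ν ≤ OuterMeasure.mkMetric fun r => r ^ (3 : ℝ) := by
    refine OuterMeasure.le_mkMetric _ _ 1 one_pos fun s hs => ?_
    rcases s.eq_empty_or_nonempty with rfl | ⟨x, hx⟩
    · simp
    have hfin : Metric.ediam s ≠ ∞ := ne_top_of_le_ne_top ENNReal.one_ne_top hs
    have hsub : s ⊆ Metric.closedBall x (Metric.diam s) := fun y hy =>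
      Metric.dist_le_diam_of_mem' hfin hy hx
    have h := W.volume_shadow_le Metric.diam_nonneg hsub fun y hy => by
      rw [← along_inv_mul]
      exact (W.abs_along_le _).trans ((le_max_left _ _).trans (hsub hy))
    have hd : Metric.ediam s = ENNReal.ofReal (Metric.diam s) := (ENNReal.ofReal_toReal hfin).symm
    rw [smul_apply, hν, smul_eq_mul, hd,
      ENNReal.ofReal_rpow_of_nonneg Metric.diam_nonneg (by norm_num)]
    calc (6 : ℝ≥0∞)⁻¹ * volume (W.shadow '' s)
        ≤ 6⁻¹ * ENNReal.ofReal (6 * Metric.diam s * Metric.diam s ^ 2) := by gcongr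
      _ = (6 : ℝ≥0∞)⁻¹ * (6 * ENNReal.ofReal (Metric.diam s ^ (3 : ℝ))) := by
          congr 1
          rw [← ENNReal.ofReal_ofNat 6, ← ENNReal.ofReal_mul (by norm_num)]
          congr 1
          norm_cast
          ring
      _ = ENNReal.ofReal (Metric.diam s ^ (3 : ℝ)) := by rw [← mul_assoc, h6, one_mul]
      _ ≤ _ := le_rfl
  have h := key A
  rw [smul_apply, hν, smul_eq_mul, ← Measure.mkMetric_toOuterMeasure] at h
  calc volume (W.shadow '' A) = 6 * (6⁻¹ * volume (W.shadow '' A)) := by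
        rw [← mul_assoc, mul_comm 6, h6, one_mul]
    _ ≤ 6 * μH[3] A := by gcongr; exact h

end VerticalSubgroup

/-! ### Flatness, planar strips and transversality. -/

/-- A point close to a coset of a vertical subgroup projects close to a line. -/
theorem exists_smul_dir_of_infEDist_lt {W : VerticalSubgroup} {z y : Heisenberg} {η : ℝ}
    (h : Metric.infEDist y (W.coset z) < ENNReal.ofReal η) :
    ∃ c : ℝ, ‖y.z - z.z - c • W.dir‖ ≤ η := by
  obtain ⟨q, ⟨w, hw, rfl⟩, hq⟩ := Metric.infEDist_lt_iff.1 h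
  obtain ⟨c, hc⟩ := Submodule.mem_span_singleton.1 (show w.z ∈ W.line from hw)
  refine ⟨c, ?_⟩
  have h1 := norm_z_sub_le_dist y (z * w)
  rw [edist_dist, ENNReal.ofReal_lt_ofReal_iff'] at hq
  rw [hc]
  refine le_trans (le_of_eq ?_) (h1.trans hq.1.le)
  simp only [mul_z]
  congr 1
  ring

/-- A small `β`-number means that the ball projects into a thin strip in the plane. -/
theorem exists_strip_of_beta_le {E : Set Heisenberg} {x : Heisenberg} {r ε : ℝ} (hr : 0 < r)
    (hε : 0 < ε) (h : beta E x r ≤ ENNReal.ofReal ε) :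
    ∃ (W : VerticalSubgroup) (z : ℂ), ∀ y ∈ Metric.closedBall x r ∩ E,
      ∃ c : ℝ, ‖y.z - z - c • W.dir‖ ≤ 2 * ε * r := by
  -- The infimum need not be attained; doubling `ε` leaves room to choose a plane.
  have h2 : beta E x r < ENNReal.ofReal (2 * ε) :=
    h.trans_lt ((ENNReal.ofReal_lt_ofReal_iff (by positivity)).2 (by linarith))
  simp only [beta, iInf_lt_iff] at h2
  obtain ⟨W, z, h3⟩ := h2
  refine ⟨W, z.z, fun y hy => exists_smul_dir_of_infEDist_lt (W := W) (z := z) ?_⟩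
  have h4 : Metric.infEDist y (W.coset z) / ENNReal.ofReal r < ENNReal.ofReal (2 * ε) :=
    lt_of_le_of_lt (le_iSup₂ (f := fun y (_ : y ∈ Metric.closedBall x r ∩ E) =>
      Metric.infEDist y (W.coset z) / ENNReal.ofReal r) y hy) h3
  rw [ENNReal.ofReal_mul (by positivity)]
  exact (ENNReal.div_lt_iff (Or.inl (by simpa using hr)) (Or.inl ENNReal.ofReal_ne_top)).1 h4

/-- Monotonicity of `β`-numbers, up to the ratio of the radii. -/
theorem lt_beta_of_closedBall_subset {E : Set Heisenberg} {x y : Heisenberg} {r s ε : ℝ}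
    (hr : 0 < r) (hs : 0 < s) (hsub : Metric.closedBall y r ⊆ Metric.closedBall x s)
    (h : ENNReal.ofReal ε < beta E y r) : ENNReal.ofReal (ε * r / s) < beta E x s := by
  have hle : beta E y r ≤ beta E x s * ENNReal.ofReal (s / r) := by
    have hc0 : ENNReal.ofReal (s / r) ≠ 0 := by simpa using div_pos hs hr
    have hc : ENNReal.ofReal (s / r) ≠ ∞ := ENNReal.ofReal_ne_top
    rw [← ENNReal.div_le_iff hc0 hc]
    refine le_iInf₂ fun W z => ?_
    rw [ENNReal.div_le_iff hc0 hc]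
    refine (iInf₂_le W z).trans (iSup₂_le fun q hq => ?_)
    have h1 : Metric.infEDist q (W.coset z) / ENNReal.ofReal s ≤ betaPlane E x s W z :=
      le_iSup₂ (f := fun y (_ : y ∈ Metric.closedBall x s ∩ E) =>
        Metric.infEDist y (W.coset z) / ENNReal.ofReal s) q ⟨hsub hq.1, hq.2⟩
    refine le_trans (le_of_eq ?_) (mul_le_mul_left h1 _)
    rw [ENNReal.ofReal_div_of_pos hr, div_eq_mul_inv, div_eq_mul_inv, div_eq_mul_inv, mul_assoc,
      ← mul_assoc (ENNReal.ofReal s)⁻¹,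
      ENNReal.inv_mul_cancel (by simpa using hs) ENNReal.ofReal_ne_top, one_mul]
  by_contra hcon
  rw [not_lt] at hcon
  refine absurd h (not_lt.2 (hle.trans ((mul_le_mul_left hcon _).trans ?_)))
  rw [← ENNReal.ofReal_mul' (by positivity)]
  refine (congrArg ENNReal.ofReal ?_).le
  field_simp

/-- Two points of a ball that lies in a thin strip transversal to the kernel of the vertical
projection, and has a large projection, are in the position required by an intrinsic Lipschitz
graph. -/
theorem projH_le_of_strip {E : Set Heisenberg} {W W' : VerticalSubgroup} {x : Heisenberg} {z : ℂ}
    {r δ η : ℝ} (hr : 0 < r) (hδ : 0 < δ) (hη : η ≤ δ / 768) (hη0 : 0 ≤ η) (hη1 : η ≤ 1 / 16)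
    (hstrip : ∀ y ∈ Metric.closedBall x r ∩ E, ∃ c : ℝ, ‖y.z - z - c • W'.dir‖ ≤ η * r)
    (hx : x ∈ E) (harea : ENNReal.ofReal (δ * r ^ 3) ≤
      volume (W.shadow '' (E ∩ Metric.closedBall x r)))
    {p q : Heisenberg} (hp : p ∈ Metric.closedBall x r ∩ E) (hq : q ∈ Metric.closedBall x r ∩ E)
    (hpq : r / 2 < dist q p) :
    hnorm (W.projH (p⁻¹ * q)) ≤ max 1 (192 / δ) * hnorm (W.projV (p⁻¹ * q)) := by
  -- The cosine of the angle between the two lines; transversality is a lower bound for it.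
  set κ : ℝ := |W.dir.re * W'.dir.re + W.dir.im * W'.dir.im| with hκ
  have hκ0 : 0 ≤ κ := abs_nonneg _
  -- the difference of two points is close to a multiple of the direction of the strip
  have hdiff : ∀ u ∈ Metric.closedBall x r ∩ E, ∀ v ∈ Metric.closedBall x r ∩ E,
      ∃ c : ℝ, ‖v.z - u.z - c • W'.dir‖ ≤ 2 * η * r := by
    intro u hu v hv
    obtain ⟨c, hc⟩ := hstrip u hu
    obtain ⟨d, hd⟩ := hstrip v hv
    refine ⟨d - c, ?_⟩
    have : v.z - u.z - (d - c) • W'.dir =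
        (v.z - z - d • W'.dir) - (u.z - z - c • W'.dir) := by
      rw [sub_smul]; ring
    rw [this]
    exact (norm_sub_le _ _).trans (by linarith)
  have halong : ∀ (u v : Heisenberg) (c : ℝ), ‖v.z - u.z - c • W'.dir‖ ≤ 2 * η * r →
      |W.along v - W.along u - c * (W.dir.re * W'.dir.re + W.dir.im * W'.dir.im)| ≤
        2 * η * r ∧ abs (‖v.z - u.z‖ - |c|) ≤ 2 * η * r := by
    intro u v c hc
    constructor
    · refine le_trans (le_of_eq ?_) ((W.abs_along_le ⟨v.z - u.z - c • W'.dir, 0⟩).trans hc)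
      congr 1
      simp [VerticalSubgroup.along]
      ring
    · refine le_trans ?_ ((abs_norm_sub_norm_le _ _).trans hc)
      simp [W'.norm_dir]
  -- Over the strip, `along` varies from its value at `x` by at most `(2κ + 2η) r`, so the shadow
  -- has area at most `12 (κ + η) r³`. As `η` is small against `δ`, the area hypothesis bounds `κ`
  -- below.
  have hκδ : δ / 24 ≤ κ := by
    have hρ : 0 ≤ 2 * κ + 2 * η := by linarith
    have h := harea.trans (W.volume_shadow_le (x := x) (r := r)
      (ρ := (2 * κ + 2 * η) * r) (by positivity) inter_subset_right ?_)
    · rw [ENNReal.ofReal_le_ofReal_iff (by positivity)] at h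
      have h' : δ * r ^ 3 ≤ (12 * (κ + η)) * r ^ 3 := by linarith
      have h'' := le_of_mul_le_mul_right h' (by positivity)
      linarith
    · rintro y ⟨hyE, hyB⟩
      obtain ⟨c, hc⟩ := hdiff x ⟨Metric.mem_closedBall_self hr.le, hx⟩ y ⟨hyB, hyE⟩
      obtain ⟨h1, h2⟩ := halong x y c hc
      have h3 : ‖y.z - x.z‖ ≤ r := (norm_z_sub_le_dist y x).trans hyB
      have h4 : |c| ≤ 2 * r := by
        have := (abs_le.1 h2).1
        nlinarith
      have h5 : |c * (W.dir.re * W'.dir.re + W.dir.im * W'.dir.im)| ≤ 2 * r * κ := by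
        rw [abs_mul]
        exact mul_le_mul_of_nonneg_right h4 hκ0
      have h6 := abs_add_le (W.along y - W.along x - c * (W.dir.re * W'.dir.re +
        W.dir.im * W'.dir.im)) (c * (W.dir.re * W'.dir.re + W.dir.im * W'.dir.im))
      rw [sub_add_cancel] at h6
      linarith
  set d := dist q p with hd
  have hdn : hnorm (p⁻¹ * q) = d := rfl
  have hV0 := hnorm_nonneg (W.projV (p⁻¹ * q))
  have hH : hnorm (W.projH (p⁻¹ * q)) = |W.across (p⁻¹ * q)| := by
    rw [(W.proj_eq _).2]
    simp [hnorm, W.norm_dir]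
  have hVa : |W.along (p⁻¹ * q)| ≤ hnorm (W.projV (p⁻¹ * q)) := by
    rw [(W.proj_eq _).1]
    refine le_trans (le_of_eq ?_) (le_max_left _ _)
    simp [W.norm_dir]
  have htri : d ≤ hnorm (W.projV (p⁻¹ * q)) + hnorm (W.projH (p⁻¹ * q)) := by
    rw [← hdn]
    conv_lhs => rw [← W.projV_mul_projH (p⁻¹ * q)]
    exact hnorm_mul_le _ _
  -- If the horizontal part is at most `d / 2`, the vertical part dominates it. Otherwise the
  -- displacement runs at least `d / 4` along the strip, hence at least `d κ / 4 - 4 η d ≥ d κ / 8`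
  -- along `W`.
  rcases le_or_gt (hnorm (W.projH (p⁻¹ * q))) (d / 2) with hcase | hcase
  · calc hnorm (W.projH (p⁻¹ * q)) ≤ 1 * hnorm (W.projV (p⁻¹ * q)) := by linarith
      _ ≤ _ := mul_le_mul_of_nonneg_right (le_max_left _ _) hV0
  · have hzz : (p⁻¹ * q).z = q.z - p.z := by simp; ring
    have hHz : hnorm (W.projH (p⁻¹ * q)) ≤ ‖q.z - p.z‖ := by
      rw [hH, ← hzz]
      exact W.abs_across_le _
    have hHd : hnorm (W.projH (p⁻¹ * q)) ≤ d := hHz.trans (norm_z_sub_le_dist q p)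
    obtain ⟨c, hc⟩ := hdiff p hp q hq
    obtain ⟨h1, h2⟩ := halong p q c hc
    rw [W.along_inv_mul] at hVa
    have h3 : d / 4 ≤ |c| := by
      have := (abs_le.1 h2).2
      nlinarith
    have h5 : d / 4 * κ ≤ |c * (W.dir.re * W'.dir.re + W.dir.im * W'.dir.im)| := by
      rw [abs_mul]
      exact mul_le_mul_of_nonneg_right h3 hκ0
    have h6 := abs_sub_abs_le_abs_sub (c * (W.dir.re * W'.dir.re + W.dir.im * W'.dir.im))
      (W.along q - W.along p)
    rw [abs_sub_comm (c * _)] at h6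
    have hd0 : 0 ≤ d := dist_nonneg
    have h7 : 4 * η * d ≤ d / 8 * κ := by nlinarith
    have h8 : 2 * η * r ≤ 4 * η * d := by nlinarith
    have h9 : δ / 192 * d ≤ hnorm (W.projV (p⁻¹ * q)) := by
      have := mul_le_mul_of_nonneg_right hκδ hd0
      linarith
    calc hnorm (W.projH (p⁻¹ * q)) ≤ d := hHd
      _ = 192 / δ * (δ / 192 * d) := by field_simp
      _ ≤ 192 / δ * hnorm (W.projV (p⁻¹ * q)) := by gcongr
      _ ≤ _ := mul_le_mul_of_nonneg_right (le_max_right _ _) hV0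

end Heisenberg

/-! ### Colouring and coding. -/

/-- Greedy colouring along a well-founded order, in which every vertex has a bounded number of
smaller neighbours. -/
theorem exists_coloring_of_encard_le {α : Type*} {r : α → α → Prop} (hr : WellFounded r)
    (out : α → Set α) (hout : ∀ a, ∀ b ∈ out a, r b a) (K : ℕ) (hK : ∀ a, (out a).encard ≤ K) :
    ∃ c : α → Fin (K + 1), ∀ a, ∀ b ∈ out a, c a ≠ c b := by
  classical
  have hex : ∀ (a : α) (g : (b : α) → r b a → Fin (K + 1)),
      ∃ k, ∀ b (hb : b ∈ out a), k ≠ g b (hout a b hb) := by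
    intro a g
    have hfin : (out a).Finite := Set.finite_of_encard_le_coe (hK a)
    have := hfin.fintype
    let T : Finset (Fin (K + 1)) := Finset.univ.image fun b : out a => g b (hout a b b.2)
    have hT : T.card < Finset.univ.card (α := Fin (K + 1)) := by
      refine Finset.card_image_le.trans_lt ?_
      have h := hK a
      rw [Set.encard_eq_coe_toFinset_card, Set.toFinset_card] at h
      rw [Finset.card_univ, Finset.card_univ, Fintype.card_fin]
      exact Nat.lt_succ_of_le (by exact_mod_cast h)
    obtain ⟨k, -, hk⟩ := Finset.exists_mem_notMem_of_card_lt_card hT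
    exact ⟨k, fun b hb h => hk (Finset.mem_image.2 ⟨⟨b, hb⟩, Finset.mem_univ _, h.symm⟩)⟩
  choose pick hpick using hex
  refine ⟨hr.fix pick, fun a b hb => ?_⟩
  rw [hr.fix_eq pick a]
  exact hpick a _ b hb

/-- Any set in a metric space has a net consisting of centres of disjoint balls. -/
theorem exists_disjoint_net {X : Type*} [MetricSpace X] (G : Set X) {r : ℝ} (hr : 0 < r) :
    ∃ (N : Set X) (n : X → X), N ⊆ G ∧ (N.PairwiseDisjoint fun q => Metric.closedBall q r) ∧
      ∀ x ∈ G, n x ∈ N ∧ dist x (n x) ≤ 5 * r := by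
  obtain ⟨N, hN, hd, hc⟩ := Vitali.exists_disjoint_subfamily_covering_enlargement_closedBall
    G (fun x => x) (fun _ => r) r (fun _ _ => le_rfl) 5 (by norm_num)
  have h : ∀ x, ∃ q, x ∈ G → q ∈ N ∧ dist x q ≤ 5 * r := by
    intro x
    by_cases hx : x ∈ G
    · obtain ⟨q, hq, hsub⟩ := hc x hx
      exact ⟨q, fun _ => ⟨hq, hsub (Metric.mem_closedBall_self hr.le)⟩⟩
    · exact ⟨x, fun h => absurd h hx⟩
  choose n hn using h
  exact ⟨N, n, hN, hd, hn⟩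

/-- Coding: a set each point of which is close to exceptional points at few scales only can be
split into boundedly many pieces, so that no two points of the same piece are both exceptional at
the scale of their distance. -/
theorem exists_coding {X : Type*} [MetricSpace X] (G : Set X) {ρ : ℝ} (hρ : 0 < ρ)
    (A : ℕ → Set X) (D N : ℕ)
    (hD : ∀ i : ℕ, ∀ x ∈ G, ∀ T ⊆ G, T ⊆ Metric.closedBall x (4 * (ρ / 2 ^ i)) →
      (T.PairwiseDisjoint fun q => Metric.closedBall q (ρ / 2 ^ i / 40)) → T.encard ≤ D)
    (hN : ∀ x ∈ G, {i | x ∈ Metric.thickening (3 * (ρ / 2 ^ i)) (A i)}.encard ≤ N) :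
    ∃ f : X → (Fin N → Fin (N * D + 1)), ∀ x ∈ G, ∀ y ∈ G, f x = f y → ∀ i : ℕ,
      ρ / 2 ^ (i + 1) < dist x y → dist x y ≤ ρ / 2 ^ i → x ∉ A i ∨ y ∉ A i := by
  classical
  have hpos : ∀ i : ℕ, 0 < ρ / 2 ^ i := fun i => by positivity
  have hanti : ∀ i j : ℕ, i ≤ j → ρ / 2 ^ j ≤ ρ / 2 ^ i := fun i j h =>
    div_le_div_of_nonneg_left hρ.le (by positivity) (pow_le_pow_right₀ (by norm_num) h)
  have hnet : ∀ i : ℕ, ∃ (M : Set X) (n : X → X), M ⊆ G ∧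
      (M.PairwiseDisjoint fun q => Metric.closedBall q (ρ / 2 ^ i / 40)) ∧
      ∀ x ∈ G, n x ∈ M ∧ dist x (n x) ≤ ρ / 2 ^ i / 8 := by
    intro i
    obtain ⟨M, n, h1, h2, h3⟩ := exists_disjoint_net G (r := ρ / 2 ^ i / 40)
      (by have := hpos i; positivity)
    exact ⟨M, n, h1, h2, fun x hx => ⟨(h3 x hx).1, (h3 x hx).2.trans (by linarith)⟩⟩
  choose M n hMG hMd hn using hnet
  -- A vertex `(i, q)` stands for the cell of points assigned to the net point `q` at scale `i`.
  -- Edges point to cells of the same or a coarser scale, and closeness is measured at the finer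
  -- one.
  let Edge : ℕ × X → ℕ × X → Prop := fun a b => b.1 ≤ a.1 ∧ ∃ x ∈ G, ∃ y ∈ G,
    x ∈ A a.1 ∧ n a.1 x = a.2 ∧ y ∈ A b.1 ∧ n b.1 y = b.2 ∧ dist x y ≤ ρ / 2 ^ a.1
  -- Coarser scales are coloured first. The well-order on `X` only orients the edges within one
  -- scale, where the relation is symmetric.
  let lt : ℕ × X → ℕ × X → Prop := Prod.Lex (· < ·) WellOrderingRel
  have hwf : WellFounded lt := WellFounded.prod_lex wellFounded_lt WellOrderingRel.isWellOrder.wf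
  have hcount : ∀ a, {b | Edge a b ∧ lt b a}.encard ≤ (N * D : ℕ) := by
    rintro ⟨j, q⟩
    by_cases hx : ∃ x ∈ G, x ∈ A j ∧ n j x = q
    swap
    · convert (zero_le : (0 : ℕ∞) ≤ _)
      rw [Set.encard_eq_zero, Set.eq_empty_iff_forall_notMem]
      rintro b ⟨⟨-, x, hxG, -, -, hxA, hxq, -⟩, -⟩
      exact hx ⟨x, hxG, hxA, hxq⟩
    obtain ⟨x₀, hx₀, hx₀A, rfl⟩ := hx
    have hSfin := Set.finite_of_encard_le_coe (hN x₀ hx₀)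
    let S := hSfin.toFinset
    have hTD : ∀ i, (M i ∩ Metric.closedBall x₀ (4 * (ρ / 2 ^ i))).encard ≤ D := fun i =>
      hD i x₀ hx₀ _ (inter_subset_left.trans (hMG i)) inter_subset_right
        ((hMd i).subset inter_subset_left)
    have hTfin : ∀ i, (M i ∩ Metric.closedBall x₀ (4 * (ρ / 2 ^ i))).Finite := fun i =>
      Set.finite_of_encard_le_coe (hTD i)
    let U : Finset (ℕ × X) := S.biUnion fun i => (hTfin i).toFinset.image fun q => (i, q)
    -- All edges are seen from the single point `x₀`: the far end `y` is within `1/8 + 1/8 + 1` of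
    -- the finer scale. So `i` is one of the at most `N` scales of `x₀`, with at most `D` net points
    -- in reach.
    have hsub : {b | Edge (j, n j x₀) b ∧ lt b (j, n j x₀)} ⊆ (U : Set (ℕ × X)) := by
      rintro ⟨i, q'⟩ ⟨⟨hij, x, hxG, y, hyG, hxA, hxq, hyA, hyq, hxy⟩, -⟩
      dsimp only at hij hxA hxq hyA hyq hxy
      have h1 := (hn j x₀ hx₀).2
      have h2 := (hn j x hxG).2
      have h3 := (hn i y hyG)
      rw [hxq, dist_comm] at h2
      rw [hyq] at h3
      have h4 := hanti i j hij
      have h5 : dist x₀ y ≤ 5 / 4 * (ρ / 2 ^ i) := by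
        have := dist_triangle4 x₀ (n j x₀) x y
        linarith
      have hp := hpos i
      simp only [U, Finset.coe_biUnion, Set.mem_iUnion, Finset.mem_coe, Finset.mem_image]
      refine ⟨i, ?_, q', ?_, rfl⟩
      · refine hSfin.mem_toFinset.2 (Metric.mem_thickening_iff.2 ⟨y, hyA, ?_⟩)
        linarith
      · refine (hTfin i).mem_toFinset.2 ⟨h3.1, ?_⟩
        rw [Metric.mem_closedBall, dist_comm]
        have := dist_triangle x₀ y q'
        linarith [h3.2]
    refine (Set.encard_le_encard hsub).trans ?_
    rw [Set.encard_coe_eq_coe_finsetCard]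
    have hScard : S.card ≤ N := by
      have h := hN x₀ hx₀
      rw [hSfin.encard_eq_coe_toFinset_card] at h
      exact Nat.cast_le.1 h
    have hU : U.card ≤ S.card * D := by
      refine Finset.card_biUnion_le_card_mul _ _ _ fun i _ => Finset.card_image_le.trans ?_
      have h := hTD i
      rw [(hTfin i).encard_eq_coe_toFinset_card] at h
      exact_mod_cast h
    exact_mod_cast hU.trans (Nat.mul_le_mul_right _ hScard)
  obtain ⟨c, hc⟩ := exists_coloring_of_encard_le hwf (fun a => {b | Edge a b ∧ lt b a})
    (fun a b hb => hb.2) (N * D) hcount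
  have hc' : ∀ a b, Edge a b → a ≠ b → c a ≠ c b := by
    rintro ⟨j, q⟩ ⟨i, q'⟩ hE hne
    have hij : i ≤ j := hE.1
    rcases hij.lt_or_eq with h | rfl
    · exact hc _ _ ⟨hE, Prod.Lex.left _ _ h⟩
    · have hqq : q ≠ q' := fun h => hne (by rw [h])
      rcases trichotomous_of WellOrderingRel q q' with h | h | h
      · refine (hc _ _ ⟨?_, Prod.Lex.right _ h⟩).symm
        obtain ⟨-, x, hx, y, hy, h1, h2, h3, h4, h5⟩ := hE
        exact ⟨le_rfl, y, hy, x, hx, h3, h4, h1, h2, by rwa [dist_comm]⟩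
      · exact absurd h hqq
      · exact hc _ _ ⟨hE, Prod.Lex.right _ h⟩
  -- The code of `x` lists the colours of its cells at its exceptional scales only, from coarse to
  -- fine. Beyond the last such scale `Nat.nth` returns 0; those letters are never compared.
  let f : X → (Fin N → Fin (N * D + 1)) := fun x k =>
    c (Nat.nth (fun i => x ∈ A i) k, n (Nat.nth (fun i => x ∈ A i) k) x)
  have hScard : ∀ x ∈ G, ∀ hf : (Set.ofPred fun i => x ∈ A i).Finite, hf.toFinset.card ≤ N := by
    intro x hx hf
    have h1 : (Set.ofPred fun i => x ∈ A i).encard ≤ N := by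
      refine (Set.encard_le_encard fun i hi => ?_).trans (hN x hx)
      exact Metric.self_subset_thickening (by have := hpos i; positivity) _ hi
    rw [hf.encard_eq_coe_toFinset_card] at h1
    exact_mod_cast h1
  have hSfin : ∀ x ∈ G, (Set.ofPred fun i => x ∈ A i).Finite := by
    intro x hx
    refine (Set.finite_of_encard_le_coe (hN x hx)).subset fun i hi => ?_
    exact Metric.self_subset_thickening (by have := hpos i; positivity) _ hi
  -- the case in which the first point has at most as many coarser exceptional scales
  have main : ∀ x ∈ G, ∀ y ∈ G, f x = f y → ∀ j : ℕ, ρ / 2 ^ (j + 1) < dist x y →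
      dist x y ≤ ρ / 2 ^ j → x ∈ A j → y ∈ A j →
      ¬ Nat.count (fun i => x ∈ A i) j ≤ Nat.count (fun i => y ∈ A i) j := by
    intro x hx y hy hxy j h1 h2 hxA hyA hle
    have hcx := Nat.count_lt_card (p := fun i => x ∈ A i) (hSfin x hx) hxA
    have hcy : ∀ hf : (Set.ofPred fun i => y ∈ A i).Finite, _ < hf.toFinset.card := fun hf =>
      Nat.count_lt_card (p := fun i => y ∈ A i) hf hyA
    set k := Nat.count (fun i => x ∈ A i) j with hk
    have hkN : k < N := hcx.trans_le (hScard x hx _)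
    have hfk := congrFun hxy ⟨k, hkN⟩
    simp only [f] at hfk
    rw [hk, Nat.nth_count (p := fun i => x ∈ A i) hxA, ← hk] at hfk
    -- Since `y` has at least `k` exceptional scales before `j`, and `j` itself, its scale with
    -- index `k` exists and is at most `j`. The two cells are then adjacent but equally coloured, so
    -- they coincide. That puts `x` and `y` within a quarter of the scale, although their distance
    -- exceeds half of it.
    set i := Nat.nth (fun i => y ∈ A i) k with hi
    have hiA : y ∈ A i := Nat.nth_mem (p := fun i => y ∈ A i) k fun hf => hle.trans_lt (hcy hf)
    have hij : i ≤ j := by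
      have := Nat.nth_le_nth' (p := fun i => y ∈ A i) hle hcy
      rwa [Nat.nth_count (p := fun i => y ∈ A i) hyA] at this
    refine hc' (j, n j x) (i, n i y) ⟨hij, x, hx, y, hy, hxA, rfl, hiA, rfl, h2⟩ ?_ hfk
    intro heq
    obtain ⟨h3, h4⟩ := Prod.mk.inj heq
    rw [← h3] at h4
    have h5 := (hn j x hx).2
    have h6 := (hn j y hy).2
    rw [← h4, dist_comm] at h6
    have h7 := dist_triangle x (n j x) y
    have h8 : ρ / 2 ^ (j + 1) = ρ / 2 ^ j / 2 := by rw [pow_succ]; field_simp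
    have := hpos j
    linarith
  refine ⟨f, fun x hx y hy hxy j h1 h2 => ?_⟩
  by_contra! hcon
  rcases le_total (Nat.count (fun i => x ∈ A i) j) (Nat.count (fun i => y ∈ A i) j) with h | h
  · exact main x hx y hy hxy j h1 h2 hcon.1 hcon.2 h
  · rw [dist_comm] at h1 h2
    exact main y hy x hx hxy.symm j h1 h2 hcon.2 hcon.1 h

/-! ### Packing and covering in regular sets. -/

namespace Heisenberg

/-- The two-sided volume bounds in the definition of `3`-regularity, with constant `C`. -/
def RegularWith (E : Set Heisenberg) (C : ℝ) : Prop :=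
  ∀ x ∈ E, ∀ r : ℝ, 0 < r → ENNReal.ofReal r ≤ Metric.ediam E →
    ENNReal.ofReal (C⁻¹ * r ^ 3) ≤ μH[3] (Metric.closedBall x r ∩ E) ∧
      μH[3] (Metric.closedBall x r ∩ E) ≤ ENNReal.ofReal (C * r ^ 3)

/-- The upper bound in the definition of regularity holds for all radii. -/
theorem RegularWith.measure_le {E : Set Heisenberg} {C : ℝ} (h : RegularWith E C) (hC : 1 ≤ C)
    (hE : 0 < Metric.ediam E) {x : Heisenberg} (hx : x ∈ E) {r : ℝ} (hr : 0 < r) :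
    μH[3] (Metric.closedBall x r ∩ E) ≤ ENNReal.ofReal (C * r ^ 3) := by
  rcases le_total (ENNReal.ofReal r) (Metric.ediam E) with hd | hd
  · exact (h x hx r hr hd).2
  · have hfin : Metric.ediam E ≠ ∞ := ne_top_of_le_ne_top ENNReal.ofReal_ne_top hd
    have hpos : 0 < Metric.diam E := ENNReal.toReal_pos hE.ne' hfin
    have heq : ENNReal.ofReal (Metric.diam E) = Metric.ediam E := ENNReal.ofReal_toReal hfin
    have hdr : Metric.diam E ≤ r := by
      rw [← heq] at hd
      exact (ENNReal.ofReal_le_ofReal_iff hr.le).1 hd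
    refine (measure_mono ?_).trans ((h x hx _ hpos heq.le).2.trans ?_)
    · rintro y ⟨-, hy⟩
      exact ⟨Metric.dist_le_diam_of_mem' hfin hy hx, hy⟩
    · refine ENNReal.ofReal_le_ofReal ?_
      gcongr

/-- Disjoint balls have total measure at most that of a ball containing them. -/
theorem tsum_measure_closedBall_inter_le {E : Set Heisenberg} (hE : IsClosed E)
    {T : Set Heisenberg} {ρ : Heisenberg → ℝ} {x : Heisenberg} {s : ℝ}
    (hd : T.PairwiseDisjoint fun q => Metric.closedBall q (ρ q))
    (hT : ∀ q ∈ T, Metric.closedBall q (ρ q) ⊆ Metric.closedBall x s) :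
    ∑' q : T, μH[3] (Metric.closedBall (q : Heisenberg) (ρ q) ∩ E) ≤
      μH[3] (Metric.closedBall x s ∩ E) := by
  refine (tsum_meas_le_meas_iUnion_of_disjoint μH[3]
    (fun q : T => (Metric.isClosed_closedBall.inter hE).measurableSet) ?_).trans
    (measure_mono (iUnion_subset fun q => inter_subset_inter_left _ (hT q q.2)))
  intro p q hpq
  exact (hd p.2 q.2 fun h => hpq (Subtype.ext h)).mono inter_subset_left inter_subset_left

/-- A bounded part of a regular set does not contain many disjoint balls. -/
theorem RegularWith.encard_le {E : Set Heisenberg} {C : ℝ} (h : RegularWith E C) (hC : 1 ≤ C)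
    (hE : IsClosed E) {x : Heisenberg} (hx : x ∈ E) {r : ℝ} (hr : 0 < r)
    (hrE : ENNReal.ofReal (r / 40) ≤ Metric.ediam E) {T : Set Heisenberg} (hT : T ⊆ E)
    (hTx : T ⊆ Metric.closedBall x (4 * r))
    (hd : T.PairwiseDisjoint fun q => Metric.closedBall q (r / 40)) :
    T.encard ≤ (⌈C ^ 2 * 200 ^ 3⌉₊ : ℕ) := by
  have hC0 : 0 < C := by linarith
  have hr40 : 0 < r / 40 := by positivity
  have hpos : 0 < Metric.ediam E := lt_of_lt_of_le (by simpa using hr40) hrE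
  set c := ENNReal.ofReal (C⁻¹ * (r / 40) ^ 3) with hc
  have hc0 : c ≠ 0 := by
    simp only [hc, ne_eq, ENNReal.ofReal_eq_zero, not_le]
    positivity
  -- The disjoint balls of radius `r / 40` lie in a ball of radius `5 r`; the ratio of the radii is
  -- 200.
  have h1 : (T.encard : ℝ≥0∞) * c ≤ ENNReal.ofReal (C * (5 * r) ^ 3) := by
    rw [← ENNReal.tsum_set_const]
    calc ∑' _ : T, c ≤ ∑' q : T, μH[3] (Metric.closedBall (q : Heisenberg) (r / 40) ∩ E) :=
          ENNReal.tsum_le_tsum fun q => (h q (hT q.2) _ hr40 hrE).1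
      _ ≤ μH[3] (Metric.closedBall x (5 * r) ∩ E) := by
          refine tsum_measure_closedBall_inter_le hE (ρ := fun _ => r / 40) hd fun q hq => ?_
          refine Metric.closedBall_subset_closedBall' ?_
          have := Metric.mem_closedBall.1 (hTx hq)
          linarith
      _ ≤ _ := h.measure_le hC hpos hx (by positivity)
  have h2 : ENNReal.ofReal (C * (5 * r) ^ 3) = ENNReal.ofReal (C ^ 2 * 200 ^ 3) * c := by
    rw [hc, ← ENNReal.ofReal_mul (by positivity)]
    congr 1
    field_simp
    norm_num
  rw [h2] at h1
  have h3 := (ENNReal.mul_le_mul_iff_left hc0 ENNReal.ofReal_ne_top).1 h1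
  have h4 : (T.encard : ℝ≥0∞) ≤ ((⌈C ^ 2 * 200 ^ 3⌉₊ : ℕ) : ℝ≥0∞) := by
    refine h3.trans ?_
    rw [← ENNReal.ofReal_natCast]
    exact ENNReal.ofReal_le_ofReal (Nat.le_ceil _)
  exact_mod_cast h4

/-- The points around which some ball has a small vertical projection have a small vertical
projection. -/
theorem RegularWith.volume_shadow_le {E : Set Heisenberg} {C : ℝ} (h : RegularWith E C)
    (hC : 1 ≤ C) (hE : IsClosed E) (W : VerticalSubgroup) {x : Heisenberg} (hx : x ∈ E) {R δ : ℝ}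
    (hR : 0 < R) (hRE : ENNReal.ofReal R ≤ Metric.ediam E) (hδ : 0 < δ) {B : Set Heisenberg}
    (hBE : B ⊆ E) (hBx : B ⊆ Metric.closedBall x R)
    (hB : ∀ y ∈ B, ∃ r : ℝ, 0 < r ∧ r ≤ 2 * R ∧
      volume (W.shadow '' (E ∩ Metric.closedBall y r)) ≤ ENNReal.ofReal (δ * r ^ 3)) :
    volume (W.shadow '' B) ≤ ENNReal.ofReal (1000 * C ^ 2 * δ * R ^ 3) := by
  have hC0 : 0 < C := by linarith
  have hEpos : 0 < Metric.ediam E := lt_of_lt_of_le (by simpa using hR) hRE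
  choose! r hr0 hrR hr using hB
  -- Fivefold enlargement of the balls of radius `r y / 5` restores those with small shadow. The
  -- shrunken radii are below `R`, where the lower regularity bound is available.
  obtain ⟨T, hTB, hd, hcov⟩ := Vitali.exists_disjoint_subfamily_covering_enlargement_closedBall
    B (fun y => y) (fun y => r y / 5) (2 * R / 5) (fun y hy => by linarith [hrR y hy]) 5
    (by norm_num)
  have hlow : ∀ q ∈ T, ENNReal.ofReal (C⁻¹ * (r q / 5) ^ 3) ≤
      μH[3] (Metric.closedBall q (r q / 5) ∩ E) := fun q hq =>
    (h q (hBE (hTB hq)) _ (by linarith [hr0 q (hTB hq)])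
      ((ENNReal.ofReal_le_ofReal (by linarith [hrR q (hTB hq)])).trans hRE)).1
  have hsum : ∑' q : T, μH[3] (Metric.closedBall (q : Heisenberg) (r q / 5) ∩ E) ≤
      ENNReal.ofReal (C * (2 * R) ^ 3) := by
    refine (tsum_measure_closedBall_inter_le hE (x := x) (s := 2 * R)
      (ρ := fun q => r q / 5) hd fun q hq => ?_).trans (h.measure_le hC hEpos hx (by positivity))
    refine Metric.closedBall_subset_closedBall' ?_
    have := Metric.mem_closedBall.1 (hBx (hTB hq))
    linarith [hrR q (hTB hq)]
  have hcount : T.Countable := by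
    have hs := Summable.countable_support_ennreal (ne_top_of_le_ne_top ENNReal.ofReal_ne_top hsum)
    have huniv : Function.support (fun q : T =>
        μH[3] (Metric.closedBall (q : Heisenberg) (r q / 5) ∩ E)) = univ := by
      refine eq_univ_of_forall fun q => (lt_of_lt_of_le ?_ (hlow q q.2)).ne'
      have := hr0 q (hTB q.2)
      rw [ENNReal.ofReal_pos]
      positivity
    rw [huniv] at hs
    exact countable_coe_iff.1 (countable_univ_iff.1 hs)
  have hsub : W.shadow '' B ⊆ ⋃ q ∈ T, W.shadow '' (E ∩ Metric.closedBall q (r q)) := by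
    rintro _ ⟨y, hy, rfl⟩
    obtain ⟨q, hq, hyq⟩ := hcov y hy
    refine mem_iUnion₂.2 ⟨q, hq, y, ⟨hBE hy, ?_⟩, rfl⟩
    have h5 := hyq (Metric.mem_closedBall_self (by linarith [hr0 y hy]))
    rwa [mul_div_cancel₀ _ (by norm_num : (5 : ℝ) ≠ 0)] at h5
  calc volume (W.shadow '' B)
      ≤ ∑' q : T, volume (W.shadow '' (E ∩ Metric.closedBall (q : Heisenberg) (r q))) :=
        (measure_mono hsub).trans (measure_biUnion_le _ hcount _)
    _ ≤ ∑' q : T, ENNReal.ofReal (125 * C * δ) *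
          μH[3] (Metric.closedBall (q : Heisenberg) (r q / 5) ∩ E) := by
        refine ENNReal.tsum_le_tsum fun q => (hr q (hTB q.2)).trans ?_
        refine le_trans (le_of_eq ?_) (mul_le_mul_right (hlow q q.2) _)
        rw [← ENNReal.ofReal_mul (by positivity)]
        congr 1
        field_simp
        norm_num
    _ ≤ ENNReal.ofReal (125 * C * δ) * ENNReal.ofReal (C * (2 * R) ^ 3) := by
        rw [ENNReal.tsum_mul_left]
        gcongr
    _ = _ := by
        rw [← ENNReal.ofReal_mul (by positivity)]
        congr 1
        ring

/-! ### From the weak geometric lemma to a bound on the number of nonflat scales. -/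

/-- The points of `E` at which the `β`-number at scale `r` is larger than `ε`. -/
def nonflat (E : Set Heisenberg) (ε r : ℝ) : Set Heisenberg :=
  {y | y ∈ E ∧ ENNReal.ofReal ε < beta E y r}

/-- The nonflat ball of radius `r` sits inside the ball of radius `s` about `x`, at most eight times
larger. This trades the nonflat set for an open, hence measurable, neighbourhood. -/
theorem lt_beta_of_mem_thickening {E : Set Heisenberg} {ε r s : ℝ} (hr : 0 < r) (hε : 0 < ε)
    {x : Heisenberg} (hx : x ∈ Metric.thickening (3 * r) (nonflat E ε r)) (hs : 4 * r ≤ s)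
    (hs' : s ≤ 8 * r) : ENNReal.ofReal (ε / 8) < beta E x s := by
  obtain ⟨y, hy, hxy⟩ := Metric.mem_thickening_iff.1 hx
  have hs0 : 0 < s := by linarith
  refine lt_of_le_of_lt (ENNReal.ofReal_le_ofReal ?_) (lt_beta_of_closedBall_subset hr hs0
    (Metric.closedBall_subset_closedBall' ?_) hy.2)
  · rw [le_div_iff₀ hs0]
    nlinarith
  · rw [dist_comm]
    linarith

/-- The weak geometric lemma bounds the sum over the dyadic scales of the measures of the sets of
points close to the nonflat ones. -/
theorem tsum_measure_thickening_le {E : Set Heisenberg} {ε K : ℝ} (hε : 0 < ε)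
    {x : Heisenberg} {R : ℝ} (hR : 0 < R)
    (hK : ∫⁻ s in Ioc 0 (16 * R),
        (∫⁻ y in E ∩ Metric.closedBall x (16 * R),
          {y' : Heisenberg | ENNReal.ofReal (ε / 8) < beta E y' s}.indicator 1 y ∂μH[3]) /
            ENNReal.ofReal s
      ≤ ENNReal.ofReal (K * (16 * R) ^ 3)) :
    ∑' i : ℕ, μH[3] (E ∩ Metric.closedBall x R ∩
        Metric.thickening (3 * (2 * R / 2 ^ i)) (nonflat E ε (2 * R / 2 ^ i))) ≤
      2 * ENNReal.ofReal (K * (16 * R) ^ 3) := by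
  set r : ℕ → ℝ := fun i => 2 * R / 2 ^ i with hrdef
  have hr : ∀ i, 0 < r i := fun i => by positivity
  have hanti : ∀ i j, i < j → 2 * r j ≤ r i := by
    intro i j hij
    have h1 : (2 : ℝ) ^ (i + 1) ≤ 2 ^ j := pow_le_pow_right₀ (by norm_num) hij
    simp only [hrdef]
    rw [mul_div_assoc', div_le_div_iff₀ (by positivity) (by positivity)]
    rw [pow_succ] at h1
    nlinarith
  set U : ℕ → Set Heisenberg := fun i => Metric.thickening (3 * r i) (nonflat E ε (r i)) with hU
  set m : ℕ → ℝ≥0∞ := fun i => μH[3] (E ∩ Metric.closedBall x R ∩ U i) with hm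
  set F : ℝ → ℝ≥0∞ := fun s => (∫⁻ y in E ∩ Metric.closedBall x (16 * R),
    {y' : Heisenberg | ENNReal.ofReal (ε / 8) < beta E y' s}.indicator 1 y ∂μH[3]) /
      ENNReal.ofReal s with hF
  -- On this interval `ds / s` has mass at least `4 r / (8 r)`. The intervals are disjoint and end
  -- at `8 * r 0 = 16 * R`.
  have hI : ∀ i, m i / 2 ≤ ∫⁻ s in Ioc (4 * r i) (8 * r i), F s := by
    intro i
    calc m i / 2 = ∫⁻ _ in Ioc (4 * r i) (8 * r i), m i / ENNReal.ofReal (8 * r i) := by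
          rw [setLIntegral_const, Real.volume_Ioc, ENNReal.div_eq_inv_mul, ENNReal.div_eq_inv_mul,
            mul_right_comm]
          congr 1
          rw [← ENNReal.ofReal_inv_of_pos (by linarith [hr i]),
            ← ENNReal.ofReal_mul (by have := hr i; positivity), ← ENNReal.ofReal_ofNat 2,
            ← ENNReal.ofReal_inv_of_pos (by norm_num)]
          congr 1
          have := (hr i).ne'
          field_simp
          norm_num
      _ ≤ _ := by
          refine setLIntegral_mono' measurableSet_Ioc fun s hs => ?_
          refine ENNReal.div_le_div ?_ (ENNReal.ofReal_le_ofReal hs.2)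
          have hUm : MeasurableSet (U i) := Metric.isOpen_thickening.measurableSet
          calc m i ≤ μH[3] (U i ∩ (E ∩ Metric.closedBall x (16 * R))) := by
                refine measure_mono ?_
                rintro y ⟨⟨h1, h2⟩, h3⟩
                exact ⟨h3, h1, Metric.closedBall_subset_closedBall (by linarith) h2⟩
            _ = ∫⁻ y in E ∩ Metric.closedBall x (16 * R), (U i).indicator 1 y ∂μH[3] := by
                rw [lintegral_indicator_one hUm, Measure.restrict_apply hUm]
            _ ≤ _ := by
                refine lintegral_mono fun y => indicator_le_indicator_of_subset ?_
                  (fun _ => zero_le) y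
                exact fun y hy => lt_beta_of_mem_thickening (hr i) hε hy hs.1.le hs.2
  have hdisj : Pairwise (Function.onFun Disjoint fun i => Ioc (4 * r i) (8 * r i)) := by
    refine (pairwise_disjoint_on _).2 fun i j hij => ?_
    rw [Set.disjoint_left]
    intro s hs hs'
    linarith [hs.1, hs'.2, hanti i j hij]
  have hsub : ⋃ i, Ioc (4 * r i) (8 * r i) ⊆ Ioc 0 (16 * R) := by
    refine iUnion_subset fun i => Ioc_subset_Ioc (by linarith [hr i]) ?_
    have : r i ≤ 2 * R := div_le_self (by positivity) (one_le_pow₀ (by norm_num))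
    linarith
  have hsum : ∑' i, m i / 2 ≤ ENNReal.ofReal (K * (16 * R) ^ 3) :=
    calc ∑' i, m i / 2 ≤ ∑' i, ∫⁻ s in Ioc (4 * r i) (8 * r i), F s := ENNReal.tsum_le_tsum hI
      _ = ∫⁻ s in ⋃ i, Ioc (4 * r i) (8 * r i), F s :=
          (lintegral_iUnion (fun _ => measurableSet_Ioc) hdisj F).symm
      _ ≤ ∫⁻ s in Ioc 0 (16 * R), F s := lintegral_mono_set hsub
      _ ≤ _ := hK
  simp only [div_eq_mul_inv] at hsum
  rw [ENNReal.tsum_mul_right, ← div_eq_mul_inv,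
    ENNReal.div_le_iff (by norm_num) (by norm_num)] at hsum
  rwa [mul_comm]

/-- Markov's inequality for the number of sets of a sequence that contain a point. -/
theorem mul_measure_encard_le {X : Type*} [MeasurableSpace X] (μ : Measure X) {F : Set X}
    (hF : MeasurableSet F) {U : ℕ → Set X} (hU : ∀ i, MeasurableSet (U i)) (N : ℕ) :
    (N : ℝ≥0∞) * μ {x ∈ F | ¬ {i | x ∈ U i}.encard ≤ N} ≤ ∑' i, μ (F ∩ U i) := by
  have hsum : ∀ x, ∑' i, (U i).indicator (1 : X → ℝ≥0∞) x = {i | x ∈ U i}.encard := by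
    intro x
    rw [← ENNReal.tsum_set_one, tsum_subtype {i | x ∈ U i} fun _ => (1 : ℝ≥0∞)]
    rfl
  calc (N : ℝ≥0∞) * μ {x ∈ F | ¬ {i | x ∈ U i}.encard ≤ N}
      ≤ N * μ.restrict F {x | (N : ℝ≥0∞) ≤ ∑' i, (U i).indicator (1 : X → ℝ≥0∞) x} := by
        refine mul_le_mul_right ?_ _
        rw [Measure.restrict_apply' hF]
        refine measure_mono ?_
        rintro x ⟨hxF, hx⟩
        refine ⟨?_, hxF⟩
        simp only [hsum]
        change (N : ℝ≥0∞) ≤ _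
        exact_mod_cast (not_le.1 hx).le
    _ ≤ ∫⁻ x in F, ∑' i, (U i).indicator (1 : X → ℝ≥0∞) x ∂μ :=
        mul_meas_ge_le_lintegral
          (Measurable.tsum fun i => measurable_one.indicator (hU i)) _
    _ = ∑' i, μ (F ∩ U i) := by
        rw [lintegral_tsum fun i => (measurable_one.indicator (hU i)).aemeasurable]
        refine tsum_congr fun i => ?_
        rw [lintegral_indicator_one (hU i), Measure.restrict_apply (hU i), inter_comm]

/-! ### Continuity of the coordinates, and the cone condition on closures. -/

theorem continuous_z : Continuous Heisenberg.z :=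
  (LipschitzWith.of_dist_le_mul (K := 1) fun p q => by
    simpa [dist_eq_norm] using norm_z_sub_le_dist p q).continuous

/-- The coordinate `q.t` is `(p⁻¹ * q).t`, which is at most `dist q p ^ 2` in size, plus a
continuous function of `q.z`. -/
theorem continuous_t : Continuous Heisenberg.t := by
  rw [continuous_iff_continuousAt]
  intro p
  have h1 : Filter.Tendsto (fun q : Heisenberg => (p⁻¹ * q).t) (nhds p) (nhds 0) := by
    have hd : Filter.Tendsto (fun q : Heisenberg => dist q p ^ 2) (nhds p) (nhds 0) := by
      have h : Continuous fun q : Heisenberg => dist q p ^ 2 := by fun_prop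
      simpa using h.tendsto p
    exact squeeze_zero_norm (fun q => abs_t_le_hnorm_sq _) hd
  have h2 : Continuous fun q : Heisenberg => p.t + (p.z.re * q.z.im - p.z.im * q.z.re) / 2 := by
    have := continuous_z
    fun_prop
  have h3 := h1.add (h2.tendsto p)
  have heq : (fun q : Heisenberg => (p⁻¹ * q).t +
      (p.t + (p.z.re * q.z.im - p.z.im * q.z.re) / 2)) = Heisenberg.t := by
    funext q
    simp
    ring
  rw [heq] at h3
  have hlim : 0 + (p.t + (p.z.re * p.z.im - p.z.im * p.z.re) / 2) = p.t := by ring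
  rwa [hlim] at h3

namespace VerticalSubgroup

variable (W : VerticalSubgroup)

theorem hnorm_projH (p : Heisenberg) : hnorm (W.projH p) = |W.across p| := by
  rw [(W.proj_eq p).2]
  simp [hnorm, W.norm_dir]

theorem hnorm_projV (p : Heisenberg) : hnorm (W.projV p) =
    max |W.along p| (Real.sqrt |p.t - W.along p * W.across p / 2|) := by
  rw [(W.proj_eq p).1]
  simp [hnorm, W.norm_dir]

/-- If all pairs of points of a set satisfy the cone condition, so do all pairs of its closure, and
the closure is an intrinsic Lipschitz graph. -/
theorem isIntrinsicLipschitzGraph_closure {L : ℝ} (hL : 0 < L) {S : Set Heisenberg}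
    (hS : ∀ p ∈ S, ∀ q ∈ S, hnorm (W.projH (p⁻¹ * q)) ≤ L * hnorm (W.projV (p⁻¹ * q))) :
    W.IsIntrinsicLipschitzGraph L (closure S) := by
  have hclosed : IsClosed {u : Heisenberg × Heisenberg |
      hnorm (W.projH (u.1⁻¹ * u.2)) ≤ L * hnorm (W.projV (u.1⁻¹ * u.2))} := by
    have hz := continuous_z
    have ht := continuous_t
    simp only [hnorm_projH, hnorm_projV, along, across, mul_z, inv_z, mul_t, inv_t]
    exact isClosed_le (by fun_prop) (by fun_prop)
  have hcl : ∀ p ∈ closure S, ∀ q ∈ closure S,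
      hnorm (W.projH (p⁻¹ * q)) ≤ L * hnorm (W.projV (p⁻¹ * q)) := by
    intro p hp q hq
    have hpq : (p, q) ∈ closure (S ×ˢ S) := by
      rw [closure_prod_eq]
      exact ⟨hp, hq⟩
    have hmem := closure_minimal (s := S ×ˢ S) ?_ hclosed hpq
    · simpa only [mem_ofPred_eq] using hmem
    · intro u hu
      rw [mem_ofPred_eq]
      exact hS u.1 hu.1 u.2 hu.2
  intro x hx α hα hαL
  ext y
  constructor
  · rintro ⟨⟨p, hp, rfl⟩, hy⟩
    have h1 := hcl x hx _ hy
    simp only [inv_mul_cancel_left] at h1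
    have h2 : hnorm (W.projV p) ≤ α * hnorm (W.projH p) := hp
    have h3 : α * L < 1 := by rwa [lt_div_iff₀ hL] at hαL
    have hV := hnorm_nonneg (W.projV p)
    -- The cone gives `V ≤ α H` and the closed condition gives `H ≤ L V`; since `α L < 1`, both
    -- norms vanish.
    have hV0 : hnorm (W.projV p) = 0 := by
      have h4 : hnorm (W.projV p) ≤ α * L * hnorm (W.projV p) := by
        rw [mul_assoc]
        exact h2.trans (mul_le_mul_of_nonneg_left h1 hα.le)
      nlinarith
    have hH0 : hnorm (W.projH p) = 0 := by
      rw [hV0, mul_zero] at h1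
      exact le_antisymm h1 (hnorm_nonneg _)
    have hp1 : p = 1 := by
      rw [← W.projV_mul_projH p, eq_one_of_hnorm_eq_zero hV0, eq_one_of_hnorm_eq_zero hH0, mul_one]
    simp [hp1]
  · rintro rfl
    refine ⟨⟨1, ?_, mul_one y⟩, hx⟩
    change hnorm (W.projV 1) ≤ α * hnorm (W.projH 1)
    simp [hnorm_projH, hnorm_projV, along, across]

end VerticalSubgroup

/-! ### Assembly of the big piece. -/

/-- The quantitative core: at a fixed location and scale, a set with a large vertical projection
for which the flat scales are prevalent contains a large piece of an intrinsic Lipschitz graph. -/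
theorem exists_bigPiece {E : Set Heisenberg} {C : ℝ} (h : RegularWith E C) (hC : 1 ≤ C)
    (hE : IsClosed E) {δ δ' ε K : ℝ} (hδ : 0 < δ) (hδ' : δ' = δ / (4000 * C ^ 2))
    (hε : ε = min (δ' / 1536) (1 / 32)) (hK0 : 0 ≤ K) {N D : ℕ}
    (hN : 200000 * K / δ ≤ N) (hN0 : 0 < N) (hD : D = ⌈C ^ 2 * 200 ^ 3⌉₊)
    {x : Heisenberg} (hx : x ∈ E) {R : ℝ} (hR : 0 < R)
    (hRE : ENNReal.ofReal R ≤ Metric.ediam E)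
    (hK : ∫⁻ s in Ioc 0 (16 * R),
        (∫⁻ y in E ∩ Metric.closedBall x (16 * R),
          {y' : Heisenberg | ENNReal.ofReal (ε / 8) < beta E y' s}.indicator 1 y ∂μH[3]) /
            ENNReal.ofReal s
      ≤ ENNReal.ofReal (K * (16 * R) ^ 3)) {W : VerticalSubgroup}
    (hW : ENNReal.ofReal (δ * R ^ 3) ≤ W.area (W.projV '' (E ∩ Metric.closedBall x R))) :
    ∃ Γ : Set Heisenberg, W.IsIntrinsicLipschitzGraph (max 1 (192 / δ')) Γ ∧
      ENNReal.ofReal (δ / (12 * (N * D + 1) ^ N) * R ^ 3) ≤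
        μH[3] (E ∩ Γ ∩ Metric.closedBall x R) := by
  have hC0 : 0 < C := by linarith
  have hδ'0 : 0 < δ' := by rw [hδ']; positivity
  have hε0 : 0 < ε := by rw [hε]; positivity
  set F : Set Heisenberg := E ∩ Metric.closedBall x R with hF
  have hFm : MeasurableSet F := (hE.inter Metric.isClosed_closedBall).measurableSet
  -- Two points of the ball are at distance at most `2 * R`, so every pair has a scale.
  set r : ℕ → ℝ := fun i => 2 * R / 2 ^ i with hrdef
  have hr : ∀ i, 0 < r i := fun i => by positivity
  have hrR : ∀ i, r i ≤ 2 * R := fun i =>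
    div_le_self (by positivity) (one_le_pow₀ (by norm_num))
  set A : ℕ → Set Heisenberg := fun i => nonflat E ε (r i) with hA
  set U : ℕ → Set Heisenberg := fun i => Metric.thickening (3 * r i) (A i) with hU
  set B₁ : Set Heisenberg := {y ∈ F | ∃ i, volume (W.shadow '' (E ∩ Metric.closedBall y (r i))) <
    ENNReal.ofReal (δ' * r i ^ 3)} with hB₁
  set B₂ : Set Heisenberg := {y ∈ F | ¬ {i | y ∈ U i}.encard ≤ N} with hB₂
  set G : Set Heisenberg := (F \ B₁) \ B₂ with hG
  have hGF : G ⊆ F := sdiff_subset.trans sdiff_subset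
  have hGE : G ⊆ E := hGF.trans inter_subset_left
  -- the projections of the two exceptional sets
  have hv₁ : volume (W.shadow '' B₁) ≤ ENNReal.ofReal (δ / 4 * R ^ 3) := by
    refine (h.volume_shadow_le hC hE W hx hR hRE hδ'0 (B := B₁) (fun y hy => hy.1.1)
      (fun y hy => hy.1.2) ?_).trans_eq ?_
    · rintro y ⟨-, i, hi⟩
      exact ⟨r i, hr i, hrR i, hi.le⟩
    · rw [hδ']
      congr 1
      field_simp
      norm_num
  have hv₂ : volume (W.shadow '' B₂) ≤ ENNReal.ofReal (δ / 4 * R ^ 3) := by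
    have h1 := (mul_measure_encard_le μH[3] hFm
      (fun i => (Metric.isOpen_thickening (δ := 3 * r i) (E := A i)).measurableSet) N).trans
      (tsum_measure_thickening_le hε0 hR hK)
    have hNr : (0 : ℝ) < N := by exact_mod_cast hN0
    have h2 : μH[3] B₂ ≤ ENNReal.ofReal (2 * (K * (16 * R) ^ 3) / N) := by
      rw [ENNReal.ofReal_div_of_pos hNr, ENNReal.ofReal_natCast, ENNReal.le_div_iff_mul_le
        (Or.inl (by simpa using hN0.ne')) (Or.inl (ENNReal.natCast_ne_top N)), mul_comm,
        ENNReal.ofReal_mul (by norm_num), ENNReal.ofReal_ofNat]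
      exact h1
    refine (W.volume_shadow_le_hausdorff B₂).trans ((mul_le_mul_right h2 _).trans ?_)
    rw [← ENNReal.ofReal_ofNat 6, ← ENNReal.ofReal_mul (by norm_num)]
    refine ENNReal.ofReal_le_ofReal ?_
    -- The requirement is `6 * 2 * 16³ * K / N ≤ δ / 4`, that is `N ≥ 196608 * K / δ`.
    rw [div_le_iff₀ hδ] at hN
    rw [mul_div_assoc', div_le_iff₀ hNr]
    have hR3 : 0 ≤ R ^ 3 := by positivity
    nlinarith [mul_le_mul_of_nonneg_right hN hR3, mul_nonneg hK0 hR3]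
  have hvG : ENNReal.ofReal (δ / 2 * R ^ 3) ≤ volume (W.shadow '' G) := by
    rw [VerticalSubgroup.area_projV_image] at hW
    have hsub : W.shadow '' F ⊆ W.shadow '' G ∪ (W.shadow '' B₁ ∪ W.shadow '' B₂) := by
      rw [← image_union, ← image_union]
      refine image_mono fun y hy => ?_
      by_cases h1 : y ∈ B₁
      · exact Or.inr (Or.inl h1)
      by_cases h2 : y ∈ B₂
      · exact Or.inr (Or.inr h2)
      exact Or.inl ⟨⟨hy, h1⟩, h2⟩
    have h1 : ENNReal.ofReal (δ * R ^ 3) ≤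
        volume (W.shadow '' G) + ENNReal.ofReal (δ / 2 * R ^ 3) := by
      refine hW.trans ((measure_mono hsub).trans ((measure_union_le _ _).trans ?_))
      gcongr
      refine (measure_union_le _ _).trans ((add_le_add hv₁ hv₂).trans_eq ?_)
      rw [← ENNReal.ofReal_add (by positivity) (by positivity)]
      congr 1
      ring
    have h2 : ENNReal.ofReal (δ * R ^ 3) =
        ENNReal.ofReal (δ / 2 * R ^ 3) + ENNReal.ofReal (δ / 2 * R ^ 3) := by
      rw [← ENNReal.ofReal_add (by positivity) (by positivity)]
      congr 1
      ring
    rw [h2] at h1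
    exact (ENNReal.add_le_add_iff_right ENNReal.ofReal_ne_top).1 h1
  -- the coding
  obtain ⟨f, hf⟩ := exists_coding G (ρ := 2 * R) (by positivity) A D N
    (fun i y hy T hTG hTy hTd => by
      rw [hD]
      refine h.encard_le hC hE (hGE hy) (hr i) (le_trans (ENNReal.ofReal_le_ofReal ?_) hRE)
        (hTG.trans hGE) hTy hTd
      linarith [hrR i])
    (fun y hy => by
      by_contra hcon
      exact hy.2 ⟨hGF hy, hcon⟩)
  -- Pigeonhole on projected area uses subadditivity only, so the pieces need not be measurable.
  obtain ⟨c, hc⟩ : ∃ c, ENNReal.ofReal (δ / (2 * (N * D + 1) ^ N) * R ^ 3) ≤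
      volume (W.shadow '' (G ∩ f ⁻¹' {c})) := by
    by_contra! hcon
    have hsub : W.shadow '' G ⊆ ⋃ c, W.shadow '' (G ∩ f ⁻¹' {c}) := by
      rintro _ ⟨y, hy, rfl⟩
      exact mem_iUnion.2 ⟨f y, y, ⟨hy, rfl⟩, rfl⟩
    have h1 : volume (W.shadow '' G) < ENNReal.ofReal (δ / 2 * R ^ 3) := by
      calc volume (W.shadow '' G) ≤ ∑ c, volume (W.shadow '' (G ∩ f ⁻¹' {c})) :=
            (measure_mono hsub).trans (measure_iUnion_fintype_le _ _)
        _ < ∑ _c : Fin N → Fin (N * D + 1),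
              ENNReal.ofReal (δ / (2 * (N * D + 1) ^ N) * R ^ 3) :=
            ENNReal.sum_lt_sum_of_nonempty Finset.univ_nonempty fun c _ => hcon c
        _ = ENNReal.ofReal (δ / 2 * R ^ 3) := by
            rw [Finset.sum_const, Finset.card_univ, Fintype.card_fun, Fintype.card_fin,
              Fintype.card_fin, nsmul_eq_mul, ← ENNReal.ofReal_natCast,
              ← ENNReal.ofReal_mul (by positivity)]
            congr 1
            push_cast
            field_simp
    exact absurd hvG (not_le.2 h1)
  refine ⟨closure (G ∩ f ⁻¹' {c}), W.isIntrinsicLipschitzGraph_closure (by positivity) ?_, ?_⟩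
  · rintro p ⟨hpG, hpc⟩ q ⟨hqG, hqc⟩
    rcases eq_or_ne p q with rfl | hne
    · simp [VerticalSubgroup.hnorm_projH, VerticalSubgroup.hnorm_projV, VerticalSubgroup.along,
        VerticalSubgroup.across]
    have hd0 : 0 < dist p q := dist_pos.2 hne
    have hd2 : dist p q ≤ 2 * R := by
      have := dist_triangle_right p q x
      linarith [Metric.mem_closedBall.1 (hGF hpG).2, Metric.mem_closedBall.1 (hGF hqG).2]
    obtain ⟨i, hi1, hi2⟩ := exists_nat_pow_near_of_lt_one (x := dist p q / (2 * R))
      (y := 1 / 2) (by positivity) ((div_le_one (by positivity)).2 hd2) (by norm_num) (by norm_num)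
    rw [lt_div_iff₀ (by positivity), one_div, inv_pow] at hi1
    rw [div_le_iff₀ (by positivity), one_div, inv_pow] at hi2
    have hi1' : 2 * R / 2 ^ (i + 1) < dist p q := by rwa [div_eq_inv_mul]
    have hi2' : dist p q ≤ 2 * R / 2 ^ i := by rwa [div_eq_inv_mul]
    have hhalf : r i / 2 < dist q p := by
      rw [dist_comm]
      refine lt_of_eq_of_lt ?_ hi1'
      simp only [hrdef, pow_succ]
      field_simp
    have main : ∀ u ∈ G, u ∉ A i → p ∈ Metric.closedBall u (r i) →
        q ∈ Metric.closedBall u (r i) →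
        hnorm (W.projH (p⁻¹ * q)) ≤ max 1 (192 / δ') * hnorm (W.projV (p⁻¹ * q)) := by
      intro u hu huA hpu hqu
      have hβ : beta E u (r i) ≤ ENNReal.ofReal ε := by
        by_contra hcon
        exact huA ⟨hGE hu, not_le.1 hcon⟩
      obtain ⟨W', z, hstrip⟩ := exists_strip_of_beta_le (hr i) hε0 hβ
      have hε1 : ε ≤ δ' / 1536 := hε ▸ min_le_left _ _
      have hε2 : ε ≤ 1 / 32 := hε ▸ min_le_right _ _
      refine projH_le_of_strip (hr i) hδ'0 (η := 2 * ε) (by linarith) (by linarith) (by linarith)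
        hstrip (hGE hu) ?_ ⟨hpu, hGE hpG⟩ ⟨hqu, hGE hqG⟩ hhalf
      by_contra hcon
      exact hu.1.2 ⟨hGF hu, i, not_le.1 hcon⟩
    rcases hf p hpG q hqG (hpc.trans hqc.symm) i hi1' hi2' with hp | hq
    · exact main p hpG hp (Metric.mem_closedBall_self (hr i).le)
        (by rw [Metric.mem_closedBall, dist_comm]; exact hi2')
    · exact main q hqG hq hi2' (Metric.mem_closedBall_self (hr i).le)
  · have h1 : G ∩ f ⁻¹' {c} ⊆ E ∩ closure (G ∩ f ⁻¹' {c}) ∩ Metric.closedBall x R := fun y hy =>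
      ⟨⟨hGE hy.1, subset_closure hy⟩, (hGF hy.1).2⟩
    refine le_trans ?_ (measure_mono h1)
    have h2 := hc.trans (W.volume_shadow_le_hausdorff _)
    have h3 : ENNReal.ofReal (δ / (2 * (N * D + 1) ^ N) * R ^ 3) =
        6 * ENNReal.ofReal (δ / (12 * (N * D + 1) ^ N) * R ^ 3) := by
      rw [← ENNReal.ofReal_ofNat 6, ← ENNReal.ofReal_mul (by norm_num)]
      congr 1
      field_simp
      norm_num
    rw [h3] at h2
    exact (ENNReal.mul_le_mul_iff_right (by norm_num) (by norm_num)).1 h2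

end Heisenberg

end

theorem theorem1p2 (E : Set Heisenberg) (hE : Heisenberg.IsThreeRegular E)
    (hWGL : Heisenberg.SatisfiesWGL E) (hBVP : Heisenberg.HasBVP E) :
    Heisenberg.HasBPiLG E := by
  obtain ⟨hcl, C, hC, hreg⟩ := hE
  obtain ⟨δ, hδ, hproj⟩ := hBVP
  have hC0 : 0 < C := by linarith
  have hδ' : 0 < δ / (4000 * C ^ 2) := by positivity
  have hε : 0 < min (δ / (4000 * C ^ 2) / 1536) (1 / 32) / 8 := by positivity
  obtain ⟨K, hK⟩ := hWGL _ hε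
  -- The weak geometric lemma does not fix the sign of `K`.
  obtain ⟨N, hN⟩ := exists_nat_gt (200000 * max K 0 / δ)
  have hN0 : 0 < N := by
    have : (0 : ℝ) < N := lt_of_le_of_lt (by positivity) hN
    exact_mod_cast this
  refine ⟨max 1 (192 / (δ / (4000 * C ^ 2))),
    δ / (12 * (N * (⌈C ^ 2 * 200 ^ 3⌉₊ : ℕ) + 1) ^ N), le_max_left _ _, by positivity,
    fun x hx R hR hRE => ?_⟩
  obtain ⟨W, hW⟩ := hproj x hx R hR hRE
  have hKR := (hK x hx (16 * R) (by positivity)).trans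
    (ENNReal.ofReal_le_ofReal (mul_le_mul_of_nonneg_right (le_max_left K 0)
      (by positivity : 0 ≤ (16 * R) ^ 3)))
  exact ⟨W, Heisenberg.exists_bigPiece hreg hC hcl hδ rfl rfl (le_max_right _ _) hN.le hN0 rfl hx
    hR hRE hKR hW⟩
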